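/- Throughout, $n\ge 1$ is an integer, $1<p<\infty$, $1\le q\le\infty$, and $U\subset\mathbf R^n$ is open. For a measurable $f$ on $U$ (real- or vector-valued, $|f|$ being the Euclidean length) let $\lambda_{[f]}(v)=|\{x\in U:|f(x)|>v\}|$, $f^*(t)=\inf\{v:\lambda_{[f]}(v)\le t\}$, $f^{**}(t)=\frac1t\int_0^t f^*(s)\,ds$, and $$\|f\|_{(p,q)}=\Big(\int_0^\infty \big(t^{1/p}f^{**}(t)\big)^q\,\frac{dt}{t}\Big)^{1/q}\ (q<\infty),\qquad \|f\|_{(p,\infty)}=\sup_{t>0}t^{1/p}f^{**}(t).$$ $L^{(p,q)}(U;\mathbf R^m)$ is the space of (a.e. classes of) measurable $f:U\to\mathbf R^m$ with $\|f\|_{(p,q)}<\infty$; we write $L^{(p,q)}(U)$ when $m=1$. Let $r=\min(p,q)$. * $H^{1,(p,q)}(U)$ is the completion of $\{\varphi\in C^\infty(U):\|\varphi\|_{1,(p,q);U}<\infty\}$ in the norm $\|\varphi\|_{1,(p,q);U}=(\|\varphi\|_{(p,q)}^r+\|\nabla\varphi\|_{(p,q)}^r)^{1/r}$, that is, the closure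 of the set of pairs $(\varphi,\nabla\varphi)$ in $L^{(p,q)}(U)\times L^{(p,q)}(U;\mathbf R^n)$; an element $(u,\nabla u)$ is identified with the function $u$. * $H_0^{1,(p,q)}(U)$ is the closure of $C_0^\infty(U)$ in $H^{1,(p,q)}(U)$. * $W^{1,(p,q)}(U)$ is the space of $u\in L^{(p,q)}(U)$ whose weak partial derivatives $\partial_1u,\dots,\partial_nu$ exist and belong to $L^{(p,q)}(U)$, with norm $\|u\|_{(p,q)}+\sum_{i=1}^n\|\partial_iu\|_{(p,q)}$. Functions that agree almost everywhere are identified; in particular, functions on $\Omega$ and on $\Omega\setminus\{y\}$ are compared by restriction. **Theorem.** Let $\Omega\subset\mathbf R^n$ be an open set, where $n\ge1$ is an integer, let $y\in\Omega$ and $1<p<\infty$. (i) $H^{1,(p,\infty)}(\Omega)\subsetneq W^{1,(p,\infty)}(\Omega)\cap H^{1,(p,\infty)}(\Omega\setminus\{y\})$. (ii) $H^{1,(p,q)}(\Omega\setminus\{y\})\subsetneq H^{1,(p,\infty)}(\Omega\setminus\{y\})$ whenever $1\le q<\infty$. (iii) None of the spaces $H_0^{1,(p,\infty)}(\Omega)$,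 $H^{1,(p,\infty)}(\Omega)$ and $W^{1,(p,\infty)}(\Omega)$ is reflexive. -/

import Mathlib

open MeasureTheory Set Filter Topology
open scoped ENNReal ContDiff

noncomputable section

/-! ### Rearrangements and the Lorentz norm -/

/-- The distribution function `λ_{[f]}(v) = μ {x : |f x| > v}`. -/
def distributionFn {α ε : Type*} [MeasurableSpace α] [ENorm ε] (μ : Measure α) (f : α → ε)
    (v : ℝ≥0∞) : ℝ≥0∞ :=
  μ {x | v < ‖f x‖ₑ}

/-- The nonincreasing rearrangement `f^*(t) = inf {v : λ_{[f]}(v) ≤ t}`. -/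
def rearrangement {α ε : Type*} [MeasurableSpace α] [ENorm ε] (μ : Measure α) (f : α → ε)
    (t : ℝ) : ℝ≥0∞ :=
  sInf {v : ℝ≥0∞ | distributionFn μ f v ≤ ENNReal.ofReal t}

/-- The maximal function `f^{**}(t) = (1/t) ∫_0^t f^*(s) ds`, for `t > 0`. -/
def maximalRearrangement {α ε : Type*} [MeasurableSpace α] [ENorm ε] (μ : Measure α) (f : α → ε)
    (t : ℝ) : ℝ≥0∞ :=
  (ENNReal.ofReal t)⁻¹ * ∫⁻ s in Ioo 0 t, rearrangement μ f s

/-- The Lorentz norm `‖f‖_{(p,q)}`, with values in `[0, ∞]`. -/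
def lorentzENorm {α ε : Type*} [MeasurableSpace α] [ENorm ε] (p : ℝ) (q : ℝ≥0∞) (μ : Measure α)
    (f : α → ε) : ℝ≥0∞ :=
  if q = ⊤ then
    ⨆ t ∈ Ioi (0 : ℝ), ENNReal.ofReal t ^ (1 / p) * maximalRearrangement μ f t
  else
    (∫⁻ t in Ioi (0 : ℝ),
      (ENNReal.ofReal t ^ (1 / p) * maximalRearrangement μ f t) ^ q.toReal / ENNReal.ofReal t)
        ^ (1 / q.toReal)

section Rearrangement

variable {α ε : Type*} [MeasurableSpace α] [ENorm ε] {μ : Measure α}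

theorem distributionFn_antitone (f : α → ε) : Antitone (distributionFn μ f) :=
  fun _ _ h => measure_mono fun _ hx => lt_of_le_of_lt h hx

theorem rearrangement_antitone (f : α → ε) : Antitone (rearrangement μ f) := fun _ _ h =>
  sInf_le_sInf fun _ hv => le_trans hv (ENNReal.ofReal_le_ofReal h)

theorem rearrangement_le_iff (f : α → ε) (s : ℝ) (v : ℝ≥0∞) :
    rearrangement μ f s ≤ v ↔ distributionFn μ f v ≤ ENNReal.ofReal s := by
  refine ⟨fun h => ?_, fun h => sInf_le h⟩
  rcases eq_or_ne v ⊤ with rfl | hv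
  · simp [distributionFn]
  obtain ⟨w, hw, hwv, hlim⟩ := exists_seq_strictAnti_tendsto' (lt_top_iff_ne_top.2 hv)
  have hU : {x | v < ‖f x‖ₑ} = ⋃ n, {x | w n < ‖f x‖ₑ} := by
    ext x
    simp only [mem_ofPred_eq, mem_iUnion]
    exact ⟨fun hx => (hlim.eventually (gt_mem_nhds hx)).exists,
      fun ⟨n, hn⟩ => (hwv n).1.trans hn⟩
  have hmono : Monotone fun n => {x | w n < ‖f x‖ₑ} :=
    fun m n hmn x hx => lt_of_le_of_lt (hw.antitone hmn) hx
  rw [distributionFn, hU, hmono.measure_iUnion]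
  refine iSup_le fun n => ?_
  obtain ⟨u, hu, hun⟩ := sInf_lt_iff.1 (lt_of_le_of_lt h (hwv n).1)
  exact (distributionFn_antitone f hun.le).trans hu

theorem lt_rearrangement_iff (f : α → ε) (s : ℝ) (v : ℝ≥0∞) :
    v < rearrangement μ f s ↔ ENNReal.ofReal s < distributionFn μ f v := by
  rw [← not_le, rearrangement_le_iff, not_le]

theorem volume_setOf_ofReal_lt (a : ℝ≥0∞) :
    volume.restrict (Ioi (0 : ℝ)) {v | ENNReal.ofReal v < a} = a := by
  rw [Measure.restrict_apply' measurableSet_Ioi]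
  rcases eq_or_ne a ⊤ with rfl | ha
  · simp
  · have : {v : ℝ | ENNReal.ofReal v < a} ∩ Ioi 0 = Ioo 0 a.toReal := by
      ext v
      simp only [mem_inter_iff, mem_ofPred_eq, mem_Ioi, mem_Ioo]
      constructor
      · rintro ⟨h1, h2⟩
        exact ⟨h2, (ENNReal.ofReal_lt_iff_lt_toReal h2.le ha).1 h1⟩
      · rintro ⟨h1, h2⟩
        exact ⟨(ENNReal.ofReal_lt_iff_lt_toReal h1.le ha).2 h2, h1⟩
    rw [this, Real.volume_Ioo, sub_zero, ENNReal.ofReal_toReal ha]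

theorem lintegral_layercake [SFinite μ] {g : α → ℝ≥0∞} (hg : Measurable g) :
    ∫⁻ x, g x ∂μ = ∫⁻ v in Ioi (0 : ℝ), μ {x | ENNReal.ofReal v < g x} := by
  have hm : MeasurableSet {z : α × ℝ | ENNReal.ofReal z.2 < g z.1} :=
    measurableSet_lt (by fun_prop) (by fun_prop)
  have h1 := Measure.prod_apply (μ := μ) (ν := volume.restrict (Ioi (0 : ℝ))) hm
  rw [Measure.prod_apply_symm hm] at h1
  refine Eq.trans (lintegral_congr fun x => ?_) h1.symm
  exact (volume_setOf_ofReal_lt (g x)).symm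

theorem lintegral_rearrangement [SFinite μ] {g : α → ℝ≥0∞} (hg : AEMeasurable g μ) :
    ∫⁻ s in Ioi (0 : ℝ), rearrangement μ g s = ∫⁻ x, g x ∂μ := by
  have h1 : ∀ v : ℝ≥0∞, distributionFn μ g v = μ {x | v < hg.mk g x} := fun v => by
    refine measure_congr (eventuallyEq_set.2 ?_)
    filter_upwards [hg.ae_eq_mk] with x hx
    simp [hx]
  rw [lintegral_congr_ae hg.ae_eq_mk, lintegral_layercake hg.measurable_mk,
    lintegral_layercake (rearrangement_antitone g).measurable]
  refine lintegral_congr fun v => ?_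
  rw [← h1]
  simp only [lt_rearrangement_iff]
  exact volume_setOf_ofReal_lt _

/-- `∫_0^t f^* ≤ ∫ (|f| - c)_+ + t c`. -/
theorem lintegral_rearrangement_le [SFinite μ] {f : α → ε} (hf : AEMeasurable (fun x => ‖f x‖ₑ) μ)
    (t : ℝ) (c : ℝ≥0∞) :
    ∫⁻ s in Ioo 0 t, rearrangement μ f s ≤ ∫⁻ x, (‖f x‖ₑ - c) ∂μ + ENNReal.ofReal t * c := by
  have hle : ∀ s, rearrangement μ f s ≤ rearrangement μ (fun x => ‖f x‖ₑ - c) s + c := fun s => by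
    rw [rearrangement_le_iff]
    have h := (rearrangement_le_iff (μ := μ) (fun x => ‖f x‖ₑ - c) s _).1 le_rfl
    refine le_trans (measure_mono fun x hx => ?_) h
    simpa [lt_tsub_iff_right] using hx
  calc ∫⁻ s in Ioo 0 t, rearrangement μ f s
      ≤ ∫⁻ s in Ioo 0 t, (rearrangement μ (fun x => ‖f x‖ₑ - c) s + c) := lintegral_mono hle
    _ = (∫⁻ s in Ioo 0 t, rearrangement μ (fun x => ‖f x‖ₑ - c) s) + ENNReal.ofReal t * c := by
        rw [lintegral_add_right _ measurable_const]
        simp [mul_comm]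
    _ ≤ _ := by
        refine add_le_add ?_ le_rfl
        rw [← lintegral_rearrangement (hf.sub_const c)]
        exact lintegral_mono_set Ioo_subset_Ioi_self

/-- Equality in the previous bound for `c = f^*(t)`. -/
theorem le_lintegral_rearrangement [SFinite μ] {f : α → ε}
    (hf : AEMeasurable (fun x => ‖f x‖ₑ) μ) (t : ℝ) :
    ∫⁻ x, (‖f x‖ₑ - rearrangement μ f t) ∂μ + ENNReal.ofReal t * rearrangement μ f t
      ≤ ∫⁻ s in Ioo 0 t, rearrangement μ f s := by
  set c := rearrangement μ f t with hc
  have h1 : ∀ s, rearrangement μ (fun x => ‖f x‖ₑ - c) s ≤ rearrangement μ f s - c := fun s => by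
    rw [rearrangement_le_iff]
    have h := (rearrangement_le_iff (μ := μ) f s _).1 le_rfl
    refine le_trans (measure_mono fun x hx => ?_) h
    simp only [mem_ofPred_eq, enorm_eq_self] at hx ⊢
    by_contra hcon
    exact absurd hx (not_lt.2 (tsub_le_tsub_right (not_lt.1 hcon) c))
  have h2 : ∀ s, t ≤ s → rearrangement μ (fun x => ‖f x‖ₑ - c) s = 0 := fun s hs => by
    have := h1 s
    rwa [tsub_eq_zero_of_le (rearrangement_antitone f hs), nonpos_iff_eq_zero] at this
  have h3 : ∫⁻ x, (‖f x‖ₑ - c) ∂μ ≤ ∫⁻ s in Ioo 0 t, (rearrangement μ f s - c) := by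
    rw [← lintegral_rearrangement (hf.sub_const c), ← lintegral_indicator measurableSet_Ioi,
      ← lintegral_indicator measurableSet_Ioo]
    refine lintegral_mono fun s => ?_
    by_cases hs : s ∈ Ioo 0 t
    · rw [indicator_of_mem hs, indicator_of_mem (Ioo_subset_Ioi_self hs)]
      exact h1 s
    · by_cases hs0 : s ∈ Ioi (0 : ℝ)
      · rw [indicator_of_mem hs0, h2 s (not_lt.1 fun h => hs ⟨hs0, h⟩)]
        exact zero_le
      · rw [indicator_of_notMem hs0]
        exact zero_le
  calc _ ≤ (∫⁻ s in Ioo 0 t, (rearrangement μ f s - c)) + ENNReal.ofReal t * c :=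
        add_le_add h3 le_rfl
    _ = ∫⁻ s in Ioo 0 t, (rearrangement μ f s - c + c) := by
        rw [lintegral_add_right _ measurable_const]
        simp [mul_comm]
    _ = _ := by
        refine setLIntegral_congr_fun measurableSet_Ioo fun s hs => ?_
        exact tsub_add_cancel_of_le (rearrangement_antitone f hs.2.le)

end Rearrangement

section LorentzENorm

variable {α F : Type*} [MeasurableSpace α] [NormedAddCommGroup F] {μ : Measure α}

theorem maximalRearrangement_add_le [SFinite μ] {f g : α → F} (hf : AEStronglyMeasurable f μ)
    (hg : AEStronglyMeasurable g μ) (t : ℝ) :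
    maximalRearrangement μ (f + g) t
      ≤ maximalRearrangement μ f t + maximalRearrangement μ g t := by
  simp only [maximalRearrangement]
  rw [← mul_add]
  gcongr
  set a := rearrangement μ f t with ha
  set b := rearrangement μ g t with hb
  have hsub : ∀ x, ‖(f + g) x‖ₑ - (a + b) ≤ (‖f x‖ₑ - a) + (‖g x‖ₑ - b) := fun x => by
    rw [tsub_le_iff_right]
    calc ‖(f + g) x‖ₑ ≤ ‖f x‖ₑ + ‖g x‖ₑ := enorm_add_le _ _
      _ ≤ (‖f x‖ₑ - a + a) + (‖g x‖ₑ - b + b) := add_le_add le_tsub_add le_tsub_add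
      _ = _ := by ring
  calc _ ≤ ∫⁻ x, (‖(f + g) x‖ₑ - (a + b)) ∂μ + ENNReal.ofReal t * (a + b) :=
        lintegral_rearrangement_le (hf.add hg).enorm t _
    _ ≤ ∫⁻ x, ((‖f x‖ₑ - a) + (‖g x‖ₑ - b)) ∂μ + ENNReal.ofReal t * (a + b) := by
        gcongr with x
        exact hsub x
    _ = (∫⁻ x, (‖f x‖ₑ - a) ∂μ + ENNReal.ofReal t * a)
          + (∫⁻ x, (‖g x‖ₑ - b) ∂μ + ENNReal.ofReal t * b) := by
        rw [lintegral_add_left' (hf.enorm.sub_const a)]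
        ring
    _ ≤ _ := add_le_add (le_lintegral_rearrangement hf.enorm t)
        (le_lintegral_rearrangement hg.enorm t)

theorem rearrangement_congr_enorm {f g : α → F} (h : ∀ᵐ x ∂μ, ‖f x‖ₑ = ‖g x‖ₑ) :
    rearrangement μ f = rearrangement μ g := by
  have : distributionFn μ f = distributionFn μ g := by
    ext v
    refine measure_congr (eventuallyEq_set.2 ?_)
    filter_upwards [h] with x hx
    simp [hx]
  funext t
  simp only [rearrangement, this]

theorem lorentzENorm_congr_enorm {p : ℝ} {q : ℝ≥0∞} {f g : α → F}
    (h : ∀ᵐ x ∂μ, ‖f x‖ₑ = ‖g x‖ₑ) : lorentzENorm p q μ f = lorentzENorm p q μ g := by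
  simp only [lorentzENorm, maximalRearrangement, rearrangement_congr_enorm h]

theorem lorentzENorm_congr_ae {p : ℝ} {q : ℝ≥0∞} {f g : α → F} (h : f =ᵐ[μ] g) :
    lorentzENorm p q μ f = lorentzENorm p q μ g :=
  lorentzENorm_congr_enorm (h.mono fun x hx => by rw [hx])

theorem measurable_maximalRearrangement (f : α → F) : Measurable (maximalRearrangement μ f) := by
  have h : Monotone fun t : ℝ => ∫⁻ s in Ioo 0 t, rearrangement μ f s :=
    fun a b hab => lintegral_mono_set (Ioo_subset_Ioo_right hab)
  exact (ENNReal.measurable_ofReal.inv).mul h.measurable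

theorem lorentzENorm_add_le [SFinite μ] {p : ℝ} {q : ℝ≥0∞} (hq : 1 ≤ q) {f g : α → F}
    (hf : AEStronglyMeasurable f μ) (hg : AEStronglyMeasurable g μ) :
    lorentzENorm p q μ (f + g) ≤ lorentzENorm p q μ f + lorentzENorm p q μ g := by
  unfold lorentzENorm
  split_ifs with hqt
  · refine iSup₂_le fun t ht => ?_
    calc _ ≤ ENNReal.ofReal t ^ (1 / p)
            * (maximalRearrangement μ f t + maximalRearrangement μ g t) := by
          gcongr
          exact maximalRearrangement_add_le hf hg t
      _ ≤ _ := by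
          rw [mul_add]
          exact add_le_add
            (le_iSup₂ (f := fun t (_ : t ∈ Ioi (0 : ℝ)) =>
              ENNReal.ofReal t ^ (1 / p) * maximalRearrangement μ f t) t ht)
            (le_iSup₂ (f := fun t (_ : t ∈ Ioi (0 : ℝ)) =>
              ENNReal.ofReal t ^ (1 / p) * maximalRearrangement μ g t) t ht)
  · have hq1 : 1 ≤ q.toReal := by
      rw [← ENNReal.toReal_one]
      exact ENNReal.toReal_mono hqt hq
    set ν : Measure ℝ := (volume.restrict (Ioi (0 : ℝ))).withDensity
      fun t => (ENNReal.ofReal t)⁻¹ with hν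
    have hmeas : ∀ h : α → F, Measurable fun t : ℝ =>
        ENNReal.ofReal t ^ (1 / p) * maximalRearrangement μ h t := fun h =>
      ((ENNReal.measurable_ofReal).pow_const _).mul (measurable_maximalRearrangement h)
    have hint : ∀ k : ℝ → ℝ≥0∞, Measurable k →
        ∫⁻ t in Ioi (0 : ℝ), k t ^ q.toReal / ENNReal.ofReal t = ∫⁻ t, k t ^ q.toReal ∂ν := by
      intro k hk
      have hd : Measurable fun t : ℝ => (ENNReal.ofReal t)⁻¹ := ENNReal.measurable_ofReal.inv
      rw [hν, lintegral_withDensity_eq_lintegral_mul _ hd (hk.pow_const _)]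
      refine lintegral_congr fun t => ?_
      rw [Pi.mul_apply, div_eq_mul_inv, mul_comm]
    rw [hint _ (hmeas _), hint _ (hmeas _), hint _ (hmeas _)]
    refine le_trans ?_ (ENNReal.lintegral_Lp_add_le (hmeas f).aemeasurable
      (hmeas g).aemeasurable hq1)
    gcongr with t
    simp only [Pi.add_apply]
    rw [← mul_add]
    gcongr
    exact maximalRearrangement_add_le hf hg t

theorem rearrangement_smul_le [NormedSpace ℝ F] (c : ℝ) (f : α → F) (s : ℝ) :
    rearrangement μ (c • f) s ≤ ‖c‖ₑ * rearrangement μ f s := by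
  rw [rearrangement_le_iff]
  refine le_trans (measure_mono fun x hx => ?_)
    ((rearrangement_le_iff (μ := μ) f s _).1 le_rfl)
  simp only [mem_ofPred_eq, Pi.smul_apply, enorm_smul] at hx ⊢
  exact lt_of_mul_lt_mul_left' hx

theorem lorentzENorm_smul_le [NormedSpace ℝ F] {p : ℝ} {q : ℝ≥0∞} (hq : 1 ≤ q) (c : ℝ)
    (f : α → F) : lorentzENorm p q μ (c • f) ≤ ‖c‖ₑ * lorentzENorm p q μ f := by
  have hmax : ∀ t, maximalRearrangement μ (c • f) t ≤ ‖c‖ₑ * maximalRearrangement μ f t := by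
    intro t
    simp only [maximalRearrangement]
    rw [mul_left_comm, ← lintegral_const_mul _ (rearrangement_antitone f).measurable]
    gcongr with s
    exact rearrangement_smul_le c f s
  unfold lorentzENorm
  split_ifs with hqt
  · simp only [ENNReal.mul_iSup]
    refine iSup₂_mono fun t ht => ?_
    rw [mul_left_comm]
    gcongr
    exact hmax t
  · have hq1 : 1 ≤ q.toReal := by
      rw [← ENNReal.toReal_one]
      exact ENNReal.toReal_mono hqt hq
    have hq0 : 0 < q.toReal := zero_lt_one.trans_le hq1
    calc _ ≤ (∫⁻ t in Ioi (0 : ℝ), ‖c‖ₑ ^ q.toReal *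
          ((ENNReal.ofReal t ^ (1 / p) * maximalRearrangement μ f t) ^ q.toReal
            / ENNReal.ofReal t)) ^ (1 / q.toReal) := by
          gcongr with t
          rw [← mul_div_assoc, ← ENNReal.mul_rpow_of_nonneg _ _ hq0.le, mul_left_comm]
          gcongr
          exact hmax t
      _ = _ := by
          rw [lintegral_const_mul' _ _ (by simp [hq0.le]),
            ENNReal.mul_rpow_of_nonneg _ _ (by positivity), ← ENNReal.rpow_mul,
            mul_one_div_cancel hq0.ne', ENNReal.rpow_one]

theorem lorentzENorm_zero {p : ℝ} {q : ℝ≥0∞} (hq : 1 ≤ q) :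
    lorentzENorm p q μ (0 : α → F) = 0 := by
  have hr : ∀ s, rearrangement μ (0 : α → F) s = 0 := fun s => by
    rw [← nonpos_iff_eq_zero, rearrangement_le_iff]
    simp [distributionFn]
  unfold lorentzENorm
  split_ifs with hqt
  · simp [maximalRearrangement, hr]
  · have hq0 : 0 < q.toReal := ENNReal.toReal_pos (zero_lt_one.trans_le hq).ne' hqt
    simp [maximalRearrangement, hr, hq0]

theorem ae_eq_zero_of_lorentzENorm_eq_zero {p : ℝ} {q : ℝ≥0∞} (hq : 1 ≤ q) {f : α → F}
    (h : lorentzENorm p q μ f = 0) : f =ᵐ[μ] 0 := by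
  have hae : ∀ᵐ t ∂(volume.restrict (Ioi (0 : ℝ))),
      ENNReal.ofReal t ^ (1 / p) * maximalRearrangement μ f t = 0 := by
    unfold lorentzENorm at h
    split_ifs at h with hqt
    · filter_upwards [ae_restrict_mem measurableSet_Ioi] with t ht
      simp only [ENNReal.iSup_eq_zero] at h
      exact h t ht
    · have hq0 : 0 < q.toReal := ENNReal.toReal_pos (zero_lt_one.trans_le hq).ne' hqt
      rw [ENNReal.rpow_eq_zero_iff_of_pos (by positivity), lintegral_eq_zero_iff] at h
      · filter_upwards [h, ae_restrict_mem measurableSet_Ioi] with t ht ht0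
        simpa [ENNReal.div_eq_zero_iff, hq0, ENNReal.rpow_eq_zero_iff_of_pos hq0] using ht
      · exact ((((ENNReal.measurable_ofReal).pow_const _).mul
          (measurable_maximalRearrangement f)).pow_const _).div ENNReal.measurable_ofReal
  have hz : ∀ s > 0, rearrangement μ f s = 0 := by
    intro s hs
    have hne : volume.restrict (Ioi (0 : ℝ)) (Ioi s) ≠ 0 := by
      rw [Measure.restrict_apply' measurableSet_Ioi, inter_eq_left.2 (Ioi_subset_Ioi hs.le)]
      simp
    obtain ⟨t, hst, ht⟩ : ∃ t ∈ Ioi s,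
        ENNReal.ofReal t ^ (1 / p) * maximalRearrangement μ f t = 0 := by
      by_contra! hcon
      exact hne (measure_mono_null (fun t ht => hcon t ht) (ae_iff.1 hae))
    have ht0 : 0 < t := hs.trans hst
    have h0 : ENNReal.ofReal t ≠ 0 := by simpa using ht0
    have hint : ∫⁻ s in Ioo 0 t, rearrangement μ f s = 0 := by
      rcases mul_eq_zero.1 ht with h1 | h1
      · exact absurd h1 (ENNReal.rpow_pos (pos_iff_ne_zero.2 h0) ENNReal.ofReal_ne_top).ne'
      · rcases mul_eq_zero.1 h1 with h2 | h2
        · simp at h2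
        · exact h2
    have hle : ∫⁻ _ in Ioo 0 s, rearrangement μ f s ≤ ∫⁻ s in Ioo 0 t, rearrangement μ f s :=
      (setLIntegral_mono' measurableSet_Ioo fun u hu => rearrangement_antitone f hu.2.le).trans
        (lintegral_mono_set (Ioo_subset_Ioo_right (le_of_lt hst)))
    rw [hint, nonpos_iff_eq_zero] at hle
    simpa [hs.not_ge] using hle
  have hd : distributionFn μ f 0 = 0 := by
    refine le_antisymm (ENNReal.le_of_forall_pos_le_add fun e he _ => ?_) zero_le
    have := (rearrangement_le_iff (μ := μ) f e 0).1 (hz e he).le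
    simpa using this
  rw [distributionFn] at hd
  have : ∀ᵐ x ∂μ, ¬ (0 < ‖f x‖ₑ) := by simpa [ae_iff] using hd
  filter_upwards [this] with x hx
  simpa using hx

end LorentzENorm

/-! ### The Lorentz spaces `L^{(p,q)}` -/

section LorentzSpace

variable {α : Type*} [MeasurableSpace α]

/-- `L^{(p,q)}(μ; F)`: classes modulo a.e. equality of measurable functions with
`‖f‖_{(p,q)} < ∞`. -/
def LorentzSpace (p : ℝ) (q : ℝ≥0∞) [hq : Fact (1 ≤ q)] (μ : Measure α) [SFinite μ]
    (F : Type*) [NormedAddCommGroup F] [NormedSpace ℝ F] : Submodule ℝ (α →ₘ[μ] F) where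
  carrier := {f | lorentzENorm p q μ f < ⊤}
  zero_mem' := by
    change lorentzENorm p q μ ((0 : α →ₘ[μ] F) : α → F) < ⊤
    rw [lorentzENorm_congr_ae AEEqFun.coeFn_zero, lorentzENorm_zero hq.out]
    exact ENNReal.zero_lt_top
  add_mem' := by
    intro f g hf hg
    change lorentzENorm p q μ ((f + g : α →ₘ[μ] F) : α → F) < ⊤
    rw [lorentzENorm_congr_ae (AEEqFun.coeFn_add f g)]
    exact (lorentzENorm_add_le hq.out f.aestronglyMeasurable g.aestronglyMeasurable).trans_lt
      (ENNReal.add_lt_top.2 ⟨hf, hg⟩)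
  smul_mem' := by
    intro c f hf
    change lorentzENorm p q μ ((c • f : α →ₘ[μ] F) : α → F) < ⊤
    rw [lorentzENorm_congr_ae (AEEqFun.coeFn_smul c f)]
    exact (lorentzENorm_smul_le hq.out c f).trans_lt (ENNReal.mul_lt_top enorm_lt_top hf)

variable {p : ℝ} {q : ℝ≥0∞} [hq : Fact (1 ≤ q)] {μ : Measure α} [SFinite μ]
  {F : Type*} [NormedAddCommGroup F] [NormedSpace ℝ F]

/-- The norm `‖·‖_{(p,q)}` on `L^{(p,q)}(μ; F)`. -/
instance LorentzSpace.instNormedAddCommGroup : NormedAddCommGroup (LorentzSpace p q μ F) :=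
  AddGroupNorm.toNormedAddCommGroup
    { toFun := fun f => (lorentzENorm p q μ (f : α →ₘ[μ] F)).toReal
      map_zero' := by
        rw [Submodule.coe_zero, lorentzENorm_congr_ae AEEqFun.coeFn_zero,
          lorentzENorm_zero hq.out, ENNReal.toReal_zero]
      add_le' := fun f g => by
        rw [Submodule.coe_add, lorentzENorm_congr_ae (AEEqFun.coeFn_add _ _),
          ← ENNReal.toReal_add f.2.ne g.2.ne]
        exact ENNReal.toReal_mono (ENNReal.add_lt_top.2 ⟨f.2, g.2⟩).ne
          (lorentzENorm_add_le hq.out f.1.aestronglyMeasurable g.1.aestronglyMeasurable)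
      neg' := fun f => by
        rw [Submodule.coe_neg, lorentzENorm_congr_enorm]
        filter_upwards [AEEqFun.coeFn_neg (f : α →ₘ[μ] F)] with x hx
        rw [hx, Pi.neg_apply, enorm_neg]
      eq_zero_of_map_eq_zero' := fun f hf => by
        have h0 : lorentzENorm p q μ (f : α →ₘ[μ] F) = 0 :=
          ((ENNReal.toReal_eq_zero_iff _).1 hf).resolve_right f.2.ne
        exact Subtype.ext (AEEqFun.ext
          ((ae_eq_zero_of_lorentzENorm_eq_zero hq.out h0).trans AEEqFun.coeFn_zero.symm)) }

theorem LorentzSpace.norm_def (f : LorentzSpace p q μ F) :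
    ‖f‖ = (lorentzENorm p q μ (f : α →ₘ[μ] F)).toReal := rfl

instance LorentzSpace.instNormedSpace : NormedSpace ℝ (LorentzSpace p q μ F) where
  norm_smul_le c f := by
    rw [LorentzSpace.norm_def, LorentzSpace.norm_def, Submodule.coe_smul,
      lorentzENorm_congr_ae (AEEqFun.coeFn_smul _ _), ← toReal_enorm c, ← ENNReal.toReal_mul]
    exact ENNReal.toReal_mono (ENNReal.mul_lt_top enorm_lt_top f.2).ne
      (lorentzENorm_smul_le hq.out c _)

theorem LorentzSpace.coeFn_zero :
    (((0 : LorentzSpace p q μ F) : α →ₘ[μ] F) : α → F) =ᵐ[μ] 0 := AEEqFun.coeFn_zero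

theorem LorentzSpace.coeFn_add (f g : LorentzSpace p q μ F) :
    (((f + g : LorentzSpace p q μ F) : α →ₘ[μ] F) : α → F)
      =ᵐ[μ] (f : α →ₘ[μ] F) + (g : α →ₘ[μ] F) := AEEqFun.coeFn_add _ _

theorem LorentzSpace.coeFn_smul (c : ℝ) (f : LorentzSpace p q μ F) :
    (((c • f : LorentzSpace p q μ F) : α →ₘ[μ] F) : α → F)
      =ᵐ[μ] c • ((f : α →ₘ[μ] F) : α → F) := AEEqFun.coeFn_smul _ _

end LorentzSpace

/-! ### Sobolev-Lorentz spaces -/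

/-- `L^{(p,q)}(Ω; F)` for an open set `Ω ⊆ ℝⁿ`. -/
abbrev LorentzOn {n : ℕ} (p : ℝ) (q : ℝ≥0∞) [Fact (1 ≤ q)]
    (Ω : TopologicalSpace.Opens (EuclideanSpace ℝ (Fin n)))
    (F : Type*) [NormedAddCommGroup F] [NormedSpace ℝ F] :=
  LorentzSpace p q (volume.restrict (Ω : Set (EuclideanSpace ℝ (Fin n)))) F

instance fact_one_le_min {p : ℝ} {q : ℝ≥0∞} [hp : Fact (1 < p)] [hq : Fact (1 ≤ q)] :
    Fact (1 ≤ min (ENNReal.ofReal p) q) :=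
  ⟨le_min (by simpa using hp.out.le) hq.out⟩

/-- `L^{(p,q)}(Ω) × L^{(p,q)}(Ω; ℝⁿ)` with the norm `(‖u‖^r + ‖g‖^r)^{1/r}`, `r = min(p,q)`. -/
abbrev LorentzPair {n : ℕ} (p : ℝ) (q : ℝ≥0∞) [Fact (1 ≤ q)]
    (Ω : TopologicalSpace.Opens (EuclideanSpace ℝ (Fin n))) :=
  WithLp (min (ENNReal.ofReal p) q)
    (LorentzOn p q Ω ℝ × LorentzOn p q Ω (EuclideanSpace ℝ (Fin n)))

section Gradient

variable {n : ℕ} {φ ψ : EuclideanSpace ℝ (Fin n) → ℝ} {x : EuclideanSpace ℝ (Fin n)}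

theorem gradient_zero_fun : gradient (0 : EuclideanSpace ℝ (Fin n) → ℝ) = 0 := by
  funext x
  simp [gradient]

theorem gradient_add_fun (h1 : DifferentiableAt ℝ φ x) (h2 : DifferentiableAt ℝ ψ x) :
    gradient (φ + ψ) x = gradient φ x + gradient ψ x := by
  simp only [gradient, fderiv_add h1 h2, map_add]

theorem gradient_smul_fun (c : ℝ) (h : DifferentiableAt ℝ φ x) :
    gradient (c • φ) x = c • gradient φ x := by
  simp only [gradient, fderiv_const_smul h c, map_smul]

theorem differentiableAt_of_smoothOn {Ω : TopologicalSpace.Opens (EuclideanSpace ℝ (Fin n))}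
    (h : ContDiffOn ℝ ∞ φ Ω) (hx : x ∈ (Ω : Set (EuclideanSpace ℝ (Fin n)))) :
    DifferentiableAt ℝ φ x :=
  (h.contDiffAt (Ω.isOpen.mem_nhds hx)).differentiableAt (by simp)

end Gradient

/-- The functions `φ ∈ C^∞(Ω)` with `‖φ‖_{1,(p,q);Ω} < ∞`, as pairs `(φ, ∇φ)`. -/
def smoothPairs {n : ℕ} (p : ℝ) (q : ℝ≥0∞) [Fact (1 ≤ q)]
    (Ω : TopologicalSpace.Opens (EuclideanSpace ℝ (Fin n))) :
    Submodule ℝ (LorentzPair p q Ω) where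
  carrier := {w | ∃ φ : EuclideanSpace ℝ (Fin n) → ℝ, ContDiffOn ℝ ∞ φ Ω ∧
    w.fst.1 =ᵐ[volume.restrict Ω] φ ∧ w.snd.1 =ᵐ[volume.restrict Ω] gradient φ}
  zero_mem' := ⟨0, contDiffOn_const, by
    rw [WithLp.zero_fst]
    exact LorentzSpace.coeFn_zero, by
    rw [WithLp.zero_snd, gradient_zero_fun]
    exact LorentzSpace.coeFn_zero⟩
  add_mem' := by
    rintro v w ⟨φ, hφ, h1, h2⟩ ⟨ψ, hψ, h3, h4⟩
    refine ⟨φ + ψ, hφ.add hψ, (LorentzSpace.coeFn_add v.fst w.fst).trans (h1.add h3),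
      (LorentzSpace.coeFn_add v.snd w.snd).trans ((h2.add h4).trans ?_)⟩
    filter_upwards [ae_restrict_mem Ω.isOpen.measurableSet] with x hx
    exact (gradient_add_fun (differentiableAt_of_smoothOn hφ hx)
      (differentiableAt_of_smoothOn hψ hx)).symm
  smul_mem' := by
    rintro c w ⟨φ, hφ, h1, h2⟩
    refine ⟨c • φ, hφ.const_smul c, (LorentzSpace.coeFn_smul c w.fst).trans (h1.const_smul c),
      (LorentzSpace.coeFn_smul c w.snd).trans ((h2.const_smul c).trans ?_)⟩
    filter_upwards [ae_restrict_mem Ω.isOpen.measurableSet] with x hx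
    exact (gradient_smul_fun c (differentiableAt_of_smoothOn hφ hx)).symm

/-- The functions `φ ∈ C_0^∞(Ω)`, as pairs `(φ, ∇φ)`. -/
def testPairs {n : ℕ} (p : ℝ) (q : ℝ≥0∞) [Fact (1 ≤ q)]
    (Ω : TopologicalSpace.Opens (EuclideanSpace ℝ (Fin n))) :
    Submodule ℝ (LorentzPair p q Ω) where
  carrier := {w | ∃ φ : EuclideanSpace ℝ (Fin n) → ℝ, ContDiff ℝ ∞ φ ∧ HasCompactSupport φ ∧
    tsupport φ ⊆ Ω ∧
    w.fst.1 =ᵐ[volume.restrict Ω] φ ∧ w.snd.1 =ᵐ[volume.restrict Ω] gradient φ}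
  zero_mem' := ⟨0, contDiff_const, HasCompactSupport.zero, by simp [tsupport], by
    rw [WithLp.zero_fst]
    exact LorentzSpace.coeFn_zero, by
    rw [WithLp.zero_snd, gradient_zero_fun]
    exact LorentzSpace.coeFn_zero⟩
  add_mem' := by
    rintro v w ⟨φ, hφ, hφc, hφs, h1, h2⟩ ⟨ψ, hψ, hψc, hψs, h3, h4⟩
    refine ⟨φ + ψ, hφ.add hψ, hφc.add hψc,
      (tsupport_add φ ψ).trans (union_subset hφs hψs),
      (LorentzSpace.coeFn_add v.fst w.fst).trans (h1.add h3),
      (LorentzSpace.coeFn_add v.snd w.snd).trans ((h2.add h4).trans (.of_forall fun x => ?_))⟩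
    exact (gradient_add_fun (hφ.differentiable (by simp) x)
      (hψ.differentiable (by simp) x)).symm
  smul_mem' := by
    rintro c w ⟨φ, hφ, hφc, hφs, h1, h2⟩
    refine ⟨c • φ, hφ.const_smul c, hφc.smul_left (f := fun _ => c),
      (tsupport_smul_subset_right (fun _ => c) φ).trans hφs,
      (LorentzSpace.coeFn_smul c w.fst).trans (h1.const_smul c),
      (LorentzSpace.coeFn_smul c w.snd).trans ((h2.const_smul c).trans (.of_forall fun x => ?_))⟩
    exact (gradient_smul_fun c (hφ.differentiable (by simp) x)).symm

/-- `H^{1,(p,q)}(Ω)`: the completion of `{φ ∈ C^∞(Ω) : ‖φ‖_{1,(p,q);Ω} < ∞}`, realised as the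
closure of the pairs `(φ, ∇φ)` in the Banach space `L^{(p,q)}(Ω) × L^{(p,q)}(Ω; ℝⁿ)`. -/
def SobolevLorentzH {n : ℕ} (p : ℝ) (q : ℝ≥0∞) [Fact (1 < p)] [Fact (1 ≤ q)]
    (Ω : TopologicalSpace.Opens (EuclideanSpace ℝ (Fin n))) : Submodule ℝ (LorentzPair p q Ω) :=
  (smoothPairs p q Ω).topologicalClosure

/-- `H_0^{1,(p,q)}(Ω)`: the closure of `C_0^∞(Ω)` in `H^{1,(p,q)}(Ω)`. (The latter is closed, so
the closure may be taken in `L^{(p,q)}(Ω) × L^{(p,q)}(Ω; ℝⁿ)`.) -/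
def SobolevLorentzH0 {n : ℕ} (p : ℝ) (q : ℝ≥0∞) [Fact (1 < p)] [Fact (1 ≤ q)]
    (Ω : TopologicalSpace.Opens (EuclideanSpace ℝ (Fin n))) : Submodule ℝ (LorentzPair p q Ω) :=
  (testPairs p q Ω).topologicalClosure

/-- `v ∈ L¹_loc(Ω)` is the `i`-th weak partial derivative of `u ∈ L¹_loc(Ω)`. -/
def IsWeakPartial {n : ℕ} (Ω : TopologicalSpace.Opens (EuclideanSpace ℝ (Fin n))) (i : Fin n)
    (u v : EuclideanSpace ℝ (Fin n) → ℝ) : Prop :=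
  LocallyIntegrableOn u Ω ∧ LocallyIntegrableOn v Ω ∧
    ∀ φ : EuclideanSpace ℝ (Fin n) → ℝ, ContDiff ℝ ∞ φ → HasCompactSupport φ → tsupport φ ⊆ Ω →
      ∫ x in Ω, φ x * v x = -∫ x in Ω, fderiv ℝ φ x (EuclideanSpace.single i 1) * u x

section WeakPartial

variable {n : ℕ} {Ω : TopologicalSpace.Opens (EuclideanSpace ℝ (Fin n))} {i : Fin n}
  {u v u' v' : EuclideanSpace ℝ (Fin n) → ℝ}

theorem locallyIntegrableOn_congr (hu : LocallyIntegrableOn u Ω)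
    (h : u =ᵐ[volume.restrict Ω] u') : LocallyIntegrableOn u' Ω := fun x hx => by
  obtain ⟨s, hs, hint⟩ := hu x hx
  refine ⟨s ∩ Ω, inter_mem hs self_mem_nhdsWithin, ?_⟩
  exact (hint.mono_set inter_subset_left).congr_fun_ae
    (ae_restrict_of_ae_restrict_of_subset inter_subset_right h)

theorem integrableOn_mul_of_locallyIntegrableOn {φ : EuclideanSpace ℝ (Fin n) → ℝ}
    (hu : LocallyIntegrableOn u Ω) (hφ : Continuous φ) (hc : HasCompactSupport φ)
    (hs : tsupport φ ⊆ Ω) : IntegrableOn (fun x => φ x * u x) Ω := by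
  have h := (hu.integrableOn_compact_subset hs hc).continuousOn_mul hφ.continuousOn hc
  refine (integrableOn_iff_integrable_of_support_subset (fun x hx => ?_)).1 h |>.integrableOn
  exact subset_tsupport φ (left_ne_zero_of_mul hx)

theorem IsWeakPartial.zero (Ω : TopologicalSpace.Opens (EuclideanSpace ℝ (Fin n))) (i : Fin n) :
    IsWeakPartial Ω i 0 0 :=
  ⟨locallyIntegrable_zero.locallyIntegrableOn _, locallyIntegrable_zero.locallyIntegrableOn _,
    fun φ _ _ _ => by simp⟩

theorem IsWeakPartial.congr (h : IsWeakPartial Ω i u v) (hu : u =ᵐ[volume.restrict Ω] u')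
    (hv : v =ᵐ[volume.restrict Ω] v') : IsWeakPartial Ω i u' v' := by
  refine ⟨locallyIntegrableOn_congr h.1 hu, locallyIntegrableOn_congr h.2.1 hv,
    fun φ h1 h2 h3 => ?_⟩
  have e1 : ∫ x in Ω, φ x * v' x = ∫ x in Ω, φ x * v x :=
    integral_congr_ae (hv.mono fun x hx => by simp only [hx])
  have e2 : ∫ x in Ω, fderiv ℝ φ x (EuclideanSpace.single i 1) * u' x =
      ∫ x in Ω, fderiv ℝ φ x (EuclideanSpace.single i 1) * u x :=
    integral_congr_ae (hu.mono fun x hx => by simp only [hx])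
  rw [e1, e2, h.2.2 φ h1 h2 h3]

theorem IsWeakPartial.add (h : IsWeakPartial Ω i u v) (h' : IsWeakPartial Ω i u' v') :
    IsWeakPartial Ω i (u + u') (v + v') := by
  refine ⟨h.1.add h'.1, h.2.1.add h'.2.1, fun φ h1 h2 h3 => ?_⟩
  have c1 : Continuous fun x => fderiv ℝ φ x (EuclideanSpace.single i 1) :=
    (h1.continuous_fderiv (by simp)).clm_apply continuous_const
  have c2 : HasCompactSupport fun x => fderiv ℝ φ x (EuclideanSpace.single i 1) :=
    h2.fderiv_apply ℝ _
  have c3 : tsupport (fun x => fderiv ℝ φ x (EuclideanSpace.single i 1)) ⊆ Ω :=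
    (tsupport_fderiv_apply_subset ℝ _).trans h3
  simp only [Pi.add_apply, mul_add]
  rw [integral_add (integrableOn_mul_of_locallyIntegrableOn h.2.1 h1.continuous h2 h3)
      (integrableOn_mul_of_locallyIntegrableOn h'.2.1 h1.continuous h2 h3),
    integral_add (integrableOn_mul_of_locallyIntegrableOn h.1 c1 c2 c3)
      (integrableOn_mul_of_locallyIntegrableOn h'.1 c1 c2 c3),
    h.2.2 φ h1 h2 h3, h'.2.2 φ h1 h2 h3]
  ring

theorem IsWeakPartial.smul (h : IsWeakPartial Ω i u v) (c : ℝ) :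
    IsWeakPartial Ω i (c • u) (c • v) := by
  refine ⟨h.1.smul c, h.2.1.smul c, fun φ h1 h2 h3 => ?_⟩
  simp only [Pi.smul_apply, smul_eq_mul, mul_left_comm _ c, integral_const_mul]
  rw [h.2.2 φ h1 h2 h3, mul_neg]

end WeakPartial

/-- `W^{1,(p,q)}(Ω)`: the functions `u ∈ L^{(p,q)}(Ω)` with weak derivatives
`∂_i u ∈ L^{(p,q)}(Ω)`, written as `(u, (∂_1 u, …, ∂_n u))`, with the norm
`‖u‖_{(p,q)} + ∑ i, ‖∂_i u‖_{(p,q)}`. -/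
def SobolevLorentzW {n : ℕ} (p : ℝ) (q : ℝ≥0∞) [Fact (1 ≤ q)]
    (Ω : TopologicalSpace.Opens (EuclideanSpace ℝ (Fin n))) :
    Submodule ℝ (WithLp 1 (LorentzOn p q Ω ℝ × PiLp 1 fun _ : Fin n => LorentzOn p q Ω ℝ)) where
  carrier := {w | ∀ i, IsWeakPartial Ω i w.fst.1 (w.snd i).1}
  zero_mem' := fun i =>
    (IsWeakPartial.zero Ω i).congr LorentzSpace.coeFn_zero.symm LorentzSpace.coeFn_zero.symm
  add_mem' := fun {v w} hv hw i => ((hv i).add (hw i)).congr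
    (LorentzSpace.coeFn_add v.fst w.fst).symm (LorentzSpace.coeFn_add (v.snd i) (w.snd i)).symm
  smul_mem' := fun c w hw i => ((hw i).smul c).congr
    (LorentzSpace.coeFn_smul c w.fst).symm (LorentzSpace.coeFn_smul c (w.snd i)).symm

/-- The real functions (defined on all of `ℝⁿ`, but only their values on `Ω` matter) whose class
on `Ω` belongs to `H^{1,(p,q)}(Ω)`. -/
def funH {n : ℕ} (p : ℝ) (q : ℝ≥0∞) [Fact (1 < p)] [Fact (1 ≤ q)]
    (Ω : TopologicalSpace.Opens (EuclideanSpace ℝ (Fin n))) : Set (EuclideanSpace ℝ (Fin n) → ℝ) :=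
  {u | ∃ w ∈ SobolevLorentzH p q Ω, u =ᵐ[volume.restrict Ω] w.fst.1}

/-- The real functions (defined on all of `ℝⁿ`, but only their values on `Ω` matter) whose class
on `Ω` belongs to `W^{1,(p,q)}(Ω)`. -/
def funW {n : ℕ} (p : ℝ) (q : ℝ≥0∞) [Fact (1 ≤ q)]
    (Ω : TopologicalSpace.Opens (EuclideanSpace ℝ (Fin n))) : Set (EuclideanSpace ℝ (Fin n) → ℝ) :=
  {u | ∃ w ∈ SobolevLorentzW p q Ω, u =ᵐ[volume.restrict Ω] w.fst.1}

/-- `Ω ∖ {y}`. -/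
def puncture {n : ℕ} (Ω : TopologicalSpace.Opens (EuclideanSpace ℝ (Fin n)))
    (y : EuclideanSpace ℝ (Fin n)) : TopologicalSpace.Opens (EuclideanSpace ℝ (Fin n)) :=
  ⟨(Ω : Set (EuclideanSpace ℝ (Fin n))) \ {y}, Ω.isOpen.sdiff isClosed_singleton⟩

/-- A normed space is reflexive if the canonical map into its bidual is onto. -/
def IsReflexiveSpace (X : Type*) [NormedAddCommGroup X] [NormedSpace ℝ X] : Prop :=
  Function.Surjective (NormedSpace.inclusionInDoubleDual ℝ X)

end

/-! All strictness and non-reflexivity statements come from one function. Let `η` be a bump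
supported in the annulus 1 ≤ |z| ≤ 3, put r_k = ρ 4^{-k}, and let u be the sum over k of r_k^{1-n/p}
η((x-y)/r_k). The terms have disjoint supports, so u and its gradient are bounded by M |x-y|^{-n/p},
a function of weak L^p. Off y the sum is locally finite, so u is smooth on Ω \ {y} and lies in
H^{1,(p,∞)}(Ω \ {y}). Its partial sums are smooth across y and dominated by the same locally
integrable function, so the pointwise gradient is the weak gradient on all of Ω, and u lies in
W^{1,(p,∞)}(Ω).

Concentration at y is detected by the weights w_r(x) = r^{n/p-n} ψ((x-y)/r), with ψ(z) = z_i η(z).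
By scaling, the integral of w_{r_k} ∂_i u equals that of ψ ∂_i η, which is -½ ∫ η² ≠ 0, for every k
(`IsWeakPartial.setIntegral_concWeight`, `integral_coordBump_mul_fderiv_ne_zero`). On the other
side, the Hardy–Littlewood inequality gives |∫ w_r f| ≤ C t^{1/p} f^{**}(t) with t the volume of the
ball of radius 4r and C independent of r (`exists_enorm_setIntegral_concWeight_mul_le`). Two
consequences follow as r → 0.

For (i): the pairing is bounded by the weak L^p norm uniformly in r, and tends to 0 when f is
bounded near y. By density it tends to 0 for every limit of gradients of functions smooth on Ω,
since y ∈ Ω. Hence u is not in H^{1,(p,∞)}(Ω). For (ii): if q < ∞ and f ∈ L^{(p,q)}, then t^{1/p}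
f^{**}(t) → 0 (`tendsto_rpow_mul_maximalRearrangement`). Hence u is not in H^{1,(p,q)}(Ω \ {y}).

For (iii): the partial sums s_N are bounded test functions, and the functionals f_k = ∫ w_{r_k}
∂_i(·) are uniformly bounded with f_k(s_N) = c for k < N and 0 otherwise. In a reflexive space a
weak cluster point x would satisfy f_k(x) = c for all k, yet lie in the closed span of the s_N, each
finite combination of which is annihilated by f_k for large k (`not_isReflexiveSpace_of_summing`).
-/

noncomputable section

/-! ### Hardy–Littlewood inequality and comparison of Lorentz norms -/

section LorentzEstimates

variable {α ε ε' : Type*} [MeasurableSpace α] [ENorm ε] [ENorm ε'] {μ : Measure α}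

/-- Hardy–Littlewood for an indicator: with c = f^*(t), bound |f| by (|f| - c)_+ + c on A and use
that this choice of c is optimal in `le_lintegral_rearrangement`. -/
theorem setLIntegral_enorm_le_lintegral_rearrangement [SFinite μ] {f : α → ε}
    (hf : AEMeasurable (fun x => ‖f x‖ₑ) μ) {A : Set α} {t : ℝ} (hA : μ A ≤ ENNReal.ofReal t) :
    ∫⁻ x in A, ‖f x‖ₑ ∂μ ≤ ∫⁻ s in Ioo 0 t, rearrangement μ f s := by
  refine le_trans ?_ (le_lintegral_rearrangement hf t)
  set c := rearrangement μ f t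
  calc ∫⁻ x in A, ‖f x‖ₑ ∂μ ≤ ∫⁻ x in A, ((‖f x‖ₑ - c) + c) ∂μ := by
        gcongr with x
        exact le_tsub_add
    _ = ∫⁻ x in A, (‖f x‖ₑ - c) ∂μ + c * μ A := by
        rw [lintegral_add_right _ measurable_const]
        simp
    _ ≤ _ := by
        rw [mul_comm c]
        gcongr
        exact Measure.restrict_le_self

theorem ofReal_rpow_mul_maximalRearrangement_le_lorentzENorm_top {p : ℝ} (f : α → ε) {t : ℝ}
    (ht : 0 < t) :
    ENNReal.ofReal t ^ (1 / p) * maximalRearrangement μ f t ≤ lorentzENorm p ⊤ μ f := by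
  rw [lorentzENorm, if_pos rfl]
  exact le_iSup₂ (f := fun t (_ : t ∈ Ioi (0 : ℝ)) =>
    ENNReal.ofReal t ^ (1 / p) * maximalRearrangement μ f t) t ht

/-- Isolates t^{1/p} f^{**}(t), the quantity bounded by the weak norm and, for q < ∞, vanishing as t
→ 0. -/
theorem lintegral_rearrangement_eq_rpow_mul {p : ℝ} (f : α → ε) {t : ℝ} (ht : 0 < t) :
    ∫⁻ s in Ioo 0 t, rearrangement μ f s = ENNReal.ofReal t ^ (1 - 1 / p) *
      (ENNReal.ofReal t ^ (1 / p) * maximalRearrangement μ f t) := by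
  have h0 : ENNReal.ofReal t ≠ 0 := by simpa using ht
  rw [← mul_assoc, ← ENNReal.rpow_add _ _ h0 ENNReal.ofReal_ne_top, sub_add_cancel,
    ENNReal.rpow_one, maximalRearrangement, ← mul_assoc,
    ENNReal.mul_inv_cancel h0 ENNReal.ofReal_ne_top, one_mul]

theorem rearrangement_mono_enorm {f : α → ε} {g : α → ε'} (h : ∀ᵐ x ∂μ, ‖f x‖ₑ ≤ ‖g x‖ₑ) (s : ℝ) :
    rearrangement μ f s ≤ rearrangement μ g s := by
  refine sInf_le_sInf fun v hv => le_trans (measure_mono_ae ?_) hv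
  filter_upwards [h] with x hx hv'
  exact lt_of_lt_of_le hv' hx

theorem maximalRearrangement_mono_enorm {f : α → ε} {g : α → ε'} (h : ∀ᵐ x ∂μ, ‖f x‖ₑ ≤ ‖g x‖ₑ)
    (t : ℝ) : maximalRearrangement μ f t ≤ maximalRearrangement μ g t := by
  unfold maximalRearrangement
  gcongr with s
  exact rearrangement_mono_enorm h s

theorem lorentzENorm_mono_enorm {p : ℝ} {q : ℝ≥0∞} {f : α → ε} {g : α → ε'}
    (h : ∀ᵐ x ∂μ, ‖f x‖ₑ ≤ ‖g x‖ₑ) : lorentzENorm p q μ f ≤ lorentzENorm p q μ g := by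
  unfold lorentzENorm
  split_ifs
  · gcongr with t _
    exact maximalRearrangement_mono_enorm h t
  · gcongr with t
    exact maximalRearrangement_mono_enorm h t

/-- Since p > 1, s^{-1/p} is integrable at 0 and its mean over (0,t) is t^{-1/p}/(1 - 1/p). So the
norm built on f^{**} can be controlled by f^*, that is, by the distribution function. -/
theorem lorentzENorm_top_le_of_rearrangement_le {p : ℝ} (hp : 1 < p) {f : α → ε} {B : ℝ}
    (hB : 0 ≤ B) (h : ∀ s > 0, rearrangement μ f s ≤ ENNReal.ofReal (B * s ^ (-(1 / p)))) :
    lorentzENorm p ⊤ μ f ≤ ENNReal.ofReal (B / (1 - 1 / p)) := by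
  have hp1 : 1 / p < 1 := by rw [div_lt_one (by linarith)]; exact hp
  have hp0 : 0 < 1 / p := by positivity
  rw [lorentzENorm, if_pos rfl]
  refine iSup₂_le fun t ht => ?_
  have ht : 0 < t := ht
  have hint : ∫⁻ s in Ioo 0 t, rearrangement μ f s
      ≤ ENNReal.ofReal (B * (t ^ (1 - 1 / p) / (1 - 1 / p))) := by
    calc _ ≤ ∫⁻ s in Ioo 0 t, ENNReal.ofReal (B * s ^ (-(1 / p))) :=
          setLIntegral_mono' measurableSet_Ioo fun s hs => h s hs.1
      _ = ENNReal.ofReal (∫ s in Ioo 0 t, B * s ^ (-(1 / p))) := by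
          rw [ofReal_integral_eq_lintegral_ofReal]
          · have := (intervalIntegral.intervalIntegrable_rpow' (a := 0) (b := t)
              (r := -(1 / p)) (by linarith)).const_mul B
            rw [intervalIntegrable_iff_integrableOn_Ioo_of_le ht.le] at this
            exact this
          · filter_upwards [ae_restrict_mem measurableSet_Ioo] with s hs
            exact mul_nonneg hB (Real.rpow_nonneg hs.1.le _)
      _ = _ := by
          rw [← integral_Ioc_eq_integral_Ioo, ← intervalIntegral.integral_of_le ht.le,
            intervalIntegral.integral_const_mul, integral_rpow (Or.inl (by linarith))]
          rw [show -(1 / p) + 1 = 1 - 1 / p by ring, Real.zero_rpow (by linarith), sub_zero]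
  unfold maximalRearrangement
  calc _ ≤ ENNReal.ofReal t ^ (1 / p) * ((ENNReal.ofReal t)⁻¹ *
        ENNReal.ofReal (B * (t ^ (1 - 1 / p) / (1 - 1 / p)))) := by gcongr
    _ = ENNReal.ofReal (t ^ (1 / p) * (t⁻¹ * (B * (t ^ (1 - 1 / p) / (1 - 1 / p))))) := by
        rw [ENNReal.ofReal_rpow_of_pos ht, ← ENNReal.ofReal_inv_of_pos ht,
          ← ENNReal.ofReal_mul (by positivity), ← ENNReal.ofReal_mul (by positivity)]
    _ = ENNReal.ofReal (B / (1 - 1 / p)) := by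
        congr 1
        rw [Real.rpow_sub ht, Real.rpow_one]
        have : t ^ (1 / p) ≠ 0 := (Real.rpow_pos_of_pos ht _).ne'
        field_simp

/-- As t f^{**}(t) is nondecreasing, f^{**}(τ) ≥ f^{**}(t)/2 for τ in (t, 2t). The weight 1/τ ≥
1/(2t) on an interval of length t costs the outer factor 2. -/
theorem maximal_rpow_le_setLIntegral {p : ℝ} (hp : 0 < p) {q : ℝ} (hq : 0 < q) (f : α → ε) {t : ℝ}
    (ht : 0 < t) :
    (2⁻¹ * (ENNReal.ofReal t ^ (1 / p) * maximalRearrangement μ f t)) ^ q ≤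
      2 * ∫⁻ τ in Ioo t (2 * t), (ENNReal.ofReal τ ^ (1 / p) * maximalRearrangement μ f τ) ^ q
        / ENNReal.ofReal τ := by
  set K := (2⁻¹ * (ENNReal.ofReal t ^ (1 / p) * maximalRearrangement μ f t)) ^ q with hK
  have h2 : ENNReal.ofReal (2 * t) = 2 * ENNReal.ofReal t := by
    rw [ENNReal.ofReal_mul (by norm_num)]; simp
  have h0 : ENNReal.ofReal t ≠ 0 := by simpa using ht
  have h1 : ∀ τ ∈ Ioo t (2 * t), K / (2 * ENNReal.ofReal t) ≤
      (ENNReal.ofReal τ ^ (1 / p) * maximalRearrangement μ f τ) ^ q / ENNReal.ofReal τ := by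
    intro τ hτ
    have hτ2 : ENNReal.ofReal τ ≤ 2 * ENNReal.ofReal t :=
      h2 ▸ ENNReal.ofReal_le_ofReal hτ.2.le
    have hm : 2⁻¹ * maximalRearrangement μ f t ≤ maximalRearrangement μ f τ := by
      unfold maximalRearrangement
      rw [← mul_assoc, ← ENNReal.mul_inv (by simp) (by simp)]
      gcongr
      exact hτ.1.le
    refine ENNReal.div_le_div ?_ hτ2
    rw [hK, mul_left_comm]
    gcongr
    exact hτ.1.le
  calc K = 2 * (K / (2 * ENNReal.ofReal t) * ENNReal.ofReal t) := by
        rw [div_eq_mul_inv, ENNReal.mul_inv (by simp) (by simp), mul_assoc, mul_assoc,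
          ENNReal.inv_mul_cancel h0 ENNReal.ofReal_ne_top, mul_one, mul_left_comm,
          ENNReal.mul_inv_cancel (by simp) (by simp), mul_one]
    _ = 2 * ∫⁻ τ in Ioo t (2 * t), K / (2 * ENNReal.ofReal t) := by
        rw [setLIntegral_const, Real.volume_Ioo]
        congr 4
        ring
    _ ≤ _ := by
        gcongr 2 * ?_
        exact setLIntegral_mono' measurableSet_Ioo h1

/-- The embedding of L^{(p,q)} into weak L^p, obtained by enlarging (t, 2t) to the half-line; the
constant is not sharp. -/
theorem lorentzENorm_top_le {p : ℝ} (hp : 0 < p) {q : ℝ≥0∞} (hq : 1 ≤ q) (hqt : q ≠ ⊤)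
    (f : α → ε) :
    lorentzENorm p ⊤ μ f ≤ 2 * 2 ^ (1 / q.toReal) * lorentzENorm p q μ f := by
  have hq0 : 0 < q.toReal := ENNReal.toReal_pos (zero_lt_one.trans_le hq).ne' hqt
  nth_rw 1 [lorentzENorm]
  rw [if_pos rfl, lorentzENorm, if_neg hqt]
  refine iSup₂_le fun t ht => ?_
  have ht : 0 < t := ht
  have h1 := (maximal_rpow_le_setLIntegral (μ := μ) hp hq0 f ht).trans
    (mul_le_mul_right (lintegral_mono_set (fun τ hτ => ht.trans hτ.1)) 2)
  have h2 := ENNReal.rpow_le_rpow h1 (one_div_nonneg.2 hq0.le)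
  rw [← ENNReal.rpow_mul, mul_one_div_cancel hq0.ne', ENNReal.rpow_one,
    ENNReal.mul_rpow_of_nonneg _ _ (by positivity)] at h2
  rw [mul_assoc, ← ENNReal.inv_mul_le_iff (by simp) (by simp)]
  exact h2

/-- The integral defining the norm is finite, hence absolutely continuous: its part over (t, 2t)
tends to 0 and dominates the quantity at t. This is what separates q < ∞ from q = ∞. -/
theorem tendsto_rpow_mul_maximalRearrangement {p : ℝ} (hp : 0 < p) {q : ℝ≥0∞} (hq : 1 ≤ q)
    (hqt : q ≠ ⊤) {f : α → ε} (hf : lorentzENorm p q μ f ≠ ⊤) :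
    Tendsto (fun t => ENNReal.ofReal t ^ (1 / p) * maximalRearrangement μ f t) (𝓝[>] 0) (𝓝 0) := by
  have hq0 : 0 < q.toReal := ENNReal.toReal_pos (zero_lt_one.trans_le hq).ne' hqt
  rw [lorentzENorm, if_neg hqt] at hf
  have hfin : ∫⁻ t in Ioi (0 : ℝ), (ENNReal.ofReal t ^ (1 / p) * maximalRearrangement μ f t)
      ^ q.toReal / ENNReal.ofReal t ≠ ⊤ := by
    intro h
    rw [h, ENNReal.top_rpow_of_pos (by positivity)] at hf
    exact hf rfl
  have hvol : Tendsto (fun t : ℝ => (volume.restrict (Ioi (0 : ℝ))) (Ioo t (2 * t)))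
      (𝓝[>] 0) (𝓝 0) := by
    have : Tendsto (fun t : ℝ => ENNReal.ofReal (2 * t - t)) (𝓝[>] 0) (𝓝 0) := by
      have h : Tendsto (fun t : ℝ => ENNReal.ofReal (2 * t - t)) (𝓝 0)
          (𝓝 (ENNReal.ofReal (2 * 0 - 0))) :=
        (ENNReal.continuous_ofReal.comp (by fun_prop)).tendsto _
      simpa using h.mono_left nhdsWithin_le_nhds
    refine tendsto_of_tendsto_of_tendsto_of_le_of_le tendsto_const_nhds this
      (fun _ => zero_le) fun t => ?_
    exact (Measure.restrict_apply_le _ _).trans (by rw [Real.volume_Ioo])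
  have h1 := tendsto_setLIntegral_zero hfin hvol
  have h2 : Tendsto (fun t : ℝ => 2 * (2 * ∫⁻ τ in Ioo t (2 * t),
      (ENNReal.ofReal τ ^ (1 / p) * maximalRearrangement μ f τ) ^ q.toReal / ENNReal.ofReal τ
        ∂(volume.restrict (Ioi (0 : ℝ)))) ^ (1 / q.toReal)) (𝓝[>] 0) (𝓝 0) := by
    have h3 := ((ENNReal.Tendsto.const_mul h1 (Or.inr (by simp : (2 : ℝ≥0∞) ≠ ⊤))).ennrpow_const
      (1 / q.toReal))
    have h4 := ENNReal.Tendsto.const_mul h3 (Or.inr (by simp : (2 : ℝ≥0∞) ≠ ⊤))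
    simpa [hq0] using h4
  refine tendsto_of_tendsto_of_tendsto_of_le_of_le' tendsto_const_nhds h2
    (.of_forall fun _ => zero_le) ?_
  filter_upwards [self_mem_nhdsWithin] with t ht
  have ht : 0 < t := ht
  have h1 := maximal_rpow_le_setLIntegral (μ := μ) hp hq0 f ht
  have h2 := ENNReal.rpow_le_rpow h1 (one_div_nonneg.2 hq0.le)
  rw [← ENNReal.rpow_mul, mul_one_div_cancel hq0.ne', ENNReal.rpow_one] at h2
  rw [← ENNReal.inv_mul_le_iff (by simp) (by simp), Measure.restrict_restrict measurableSet_Ioo,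
    inter_eq_left.2 (Ioo_subset_Ioi_self.trans (Ioi_subset_Ioi ht.le))]
  exact h2

end LorentzEstimates

/-! ### The model function |x - y|^{-n/p} -/

section PowerOfDistance

variable {n : ℕ}

theorem volume_ball_euclidean (hn : 1 ≤ n) (y : EuclideanSpace ℝ (Fin n)) {r : ℝ} (hr : 0 ≤ r) :
    volume (Metric.ball y r) = ENNReal.ofReal (r ^ n *
      (volume (Metric.ball (0 : EuclideanSpace ℝ (Fin n)) 1)).toReal) := by
  have : Nonempty (Fin n) := ⟨⟨0, hn⟩⟩
  rw [Measure.addHaar_ball _ _ hr, finrank_euclideanSpace_fin, ENNReal.ofReal_mul (by positivity),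
    ENNReal.ofReal_toReal measure_ball_lt_top.ne]

theorem volume_unit_ball_toReal_pos :
    0 < (volume (Metric.ball (0 : EuclideanSpace ℝ (Fin n)) 1)).toReal :=
  ENNReal.toReal_pos (Metric.measure_ball_pos _ _ one_pos).ne' measure_ball_lt_top.ne

/-- `|x - y|^{-n/p}` belongs to weak `L^p`. -/
theorem lorentzENorm_rpow_dist_lt_top (hn : 1 ≤ n) {p : ℝ} (hp : 1 < p)
    (y : EuclideanSpace ℝ (Fin n)) (S : Set (EuclideanSpace ℝ (Fin n))) {M : ℝ} (hM : 0 < M) :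
    lorentzENorm p ⊤ (volume.restrict S) (fun x => M * dist x y ^ (-(n / p : ℝ))) < ⊤ := by
  set κ := (volume (Metric.ball (0 : EuclideanSpace ℝ (Fin n)) 1)).toReal with hκ
  have hκ0 : 0 < κ := volume_unit_ball_toReal_pos
  have hn0 : (0 : ℝ) < n := by exact_mod_cast hn
  have hp0 : 0 < p := by linarith
  -- With κ the volume of the unit ball, the level M (s/κ)^{-1/p} is exceeded only in the ball of
  -- radius (s/κ)^{1/n}, whose volume is exactly s.
  refine (lorentzENorm_top_le_of_rearrangement_le hp (B := M * κ ^ (1 / p)) (by positivity)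
    fun s hs => ?_).trans_lt ENNReal.ofReal_lt_top
  rw [rearrangement_le_iff, distributionFn]
  refine (Measure.restrict_apply_le _ _).trans ?_
  have hsub : {x | ENNReal.ofReal (M * κ ^ (1 / p) * s ^ (-(1 / p))) <
      ‖M * dist x y ^ (-(n / p : ℝ))‖ₑ} ⊆ Metric.ball y ((s / κ) ^ (1 / n : ℝ)) := by
    intro x hx
    have hd : 0 ≤ dist x y := dist_nonneg
    rw [mem_ofPred_eq, Real.enorm_of_nonneg (by positivity),
      ENNReal.ofReal_lt_ofReal_iff_of_nonneg (by positivity), mul_assoc,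
      mul_lt_mul_iff_right₀ hM] at hx
    -- The centre is excluded because `0 ^ (-(n / p)) = 0` for real powers, so the singularity takes
    -- the value 0 there.
    have hd0 : 0 < dist x y := by
      refine lt_of_le_of_ne hd fun h => ?_
      rw [← h, Real.zero_rpow (by simp; constructor <;> linarith)] at hx
      have : 0 < κ ^ (1 / p) * s ^ (-(1 / p)) := by positivity
      linarith
    have h1 : κ ^ (1 / p) * s ^ (-(1 / p)) = (s / κ) ^ (-(1 / p)) := by
      rw [Real.div_rpow hs.le hκ0.le, Real.rpow_neg hκ0.le, div_inv_eq_mul, mul_comm]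
    have h2 : dist x y ^ (-(n / p : ℝ)) = (dist x y ^ (n : ℝ)) ^ (-(1 / p)) := by
      rw [← Real.rpow_mul hd]
      congr 1
      ring
    rw [h1, h2, Real.rpow_lt_rpow_iff_of_neg (by positivity) (by positivity)
      (by simp; positivity)] at hx
    rw [Metric.mem_ball]
    calc dist x y = (dist x y ^ (n : ℝ)) ^ (1 / n : ℝ) := by
          rw [← Real.rpow_mul hd, mul_one_div_cancel hn0.ne', Real.rpow_one]
      _ < _ := Real.rpow_lt_rpow (by positivity) hx (by positivity)
  refine (measure_mono hsub).trans ?_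
  rw [volume_ball_euclidean hn _ (by positivity), ← hκ, ← Real.rpow_natCast, ← Real.rpow_mul
    (by positivity), one_div_mul_cancel hn0.ne', Real.rpow_one, div_mul_cancel₀ _ hκ0.ne']

end PowerOfDistance

/-! ### Pairings with bounded functions supported on sets of finite measure -/

section Pairing

variable {α : Type*} [MeasurableSpace α] {μ : Measure α} [SFinite μ]

/-- Kept in terms of the integral of f^* rather than the norm, because the decay for q < ∞ needs its
behaviour at small t. -/
theorem lintegral_enorm_mul_le_lintegral_rearrangement {f ψ : α → ℝ}
    (hf : AEStronglyMeasurable f μ) {C t : ℝ} {A : Set α} (hC : ∀ x, |ψ x| ≤ C)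
    (hA : ∀ x, x ∉ A → ψ x = 0) (hμ : μ A ≤ ENNReal.ofReal t) :
    ∫⁻ x, ‖ψ x * f x‖ₑ ∂μ ≤ ENNReal.ofReal C * ∫⁻ s in Ioo 0 t, rearrangement μ f s := by
  calc ∫⁻ x, ‖ψ x * f x‖ₑ ∂μ = ∫⁻ x in A, ‖ψ x * f x‖ₑ ∂μ := by
        refine (setLIntegral_eq_of_support_subset fun x hx => ?_).symm
        by_contra hxA
        simp [hA x hxA] at hx
    _ ≤ ∫⁻ x in A, ENNReal.ofReal C * ‖f x‖ₑ ∂μ := by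
        refine lintegral_mono fun x => ?_
        rw [enorm_mul]
        gcongr
        rw [Real.enorm_eq_ofReal_abs]
        exact ENNReal.ofReal_le_ofReal (hC x)
    _ = ENNReal.ofReal C * ∫⁻ x in A, ‖f x‖ₑ ∂μ :=
        lintegral_const_mul' _ _ ENNReal.ofReal_ne_top
    _ ≤ _ := by
        gcongr
        exact setLIntegral_enorm_le_lintegral_rearrangement hf.enorm hμ

theorem lintegral_enorm_mul_le_lorentzENorm_top {p : ℝ} {f ψ : α → ℝ}
    (hf : AEStronglyMeasurable f μ) {C t : ℝ} {A : Set α} (hC : ∀ x, |ψ x| ≤ C)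
    (hA : ∀ x, x ∉ A → ψ x = 0) (ht : 0 < t) (hμ : μ A ≤ ENNReal.ofReal t) :
    ∫⁻ x, ‖ψ x * f x‖ₑ ∂μ ≤
      ENNReal.ofReal C * (ENNReal.ofReal t ^ (1 - 1 / p) * lorentzENorm p ⊤ μ f) := by
  refine (lintegral_enorm_mul_le_lintegral_rearrangement hf hC hA hμ).trans ?_
  rw [lintegral_rearrangement_eq_rpow_mul (p := p) f ht]
  gcongr
  exact ofReal_rpow_mul_maximalRearrangement_le_lorentzENorm_top f ht

theorem integrable_mul_of_lorentzENorm_top {p : ℝ} (hp : 1 < p) {f ψ : α → ℝ}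
    (hf : AEStronglyMeasurable f μ) (hψ : AEStronglyMeasurable ψ μ)
    (hfin : lorentzENorm p ⊤ μ f < ⊤) {C t : ℝ} {A : Set α} (hC : ∀ x, |ψ x| ≤ C)
    (hA : ∀ x, x ∉ A → ψ x = 0) (ht : 0 < t) (hμ : μ A ≤ ENNReal.ofReal t) :
    Integrable (fun x => ψ x * f x) μ := by
  refine ⟨hψ.mul hf, (lintegral_enorm_mul_le_lorentzENorm_top (p := p) hf hC hA ht hμ).trans_lt ?_⟩
  have hp1 : 1 / p < 1 := by rw [div_lt_one (by linarith)]; exact hp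
  exact ENNReal.mul_lt_top ENNReal.ofReal_lt_top
    (ENNReal.mul_lt_top (ENNReal.rpow_lt_top_of_nonneg (by linarith) ENNReal.ofReal_ne_top) hfin)

theorem enorm_integral_mul_le_lorentzENorm_top {p : ℝ} {f ψ : α → ℝ}
    (hf : AEStronglyMeasurable f μ) {C t : ℝ} {A : Set α} (hC : ∀ x, |ψ x| ≤ C)
    (hA : ∀ x, x ∉ A → ψ x = 0) (ht : 0 < t) (hμ : μ A ≤ ENNReal.ofReal t) :
    ‖∫ x, ψ x * f x ∂μ‖ₑ ≤
      ENNReal.ofReal C * (ENNReal.ofReal t ^ (1 - 1 / p) * lorentzENorm p ⊤ μ f) :=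
  (enorm_integral_le_lintegral_enorm _).trans
    (lintegral_enorm_mul_le_lorentzENorm_top hf hC hA ht hμ)

end Pairing

theorem lorentzENorm_comp_clm_le {α F : Type*} [MeasurableSpace α] {μ : Measure α}
    [NormedAddCommGroup F] [NormedSpace ℝ F] {p : ℝ} {q : ℝ≥0∞}
    {ℓ : F →L[ℝ] ℝ} (hℓ : ‖ℓ‖ ≤ 1) (f : α → F) :
    lorentzENorm p q μ (fun x => ℓ (f x)) ≤ lorentzENorm p q μ f := by
  refine lorentzENorm_mono_enorm (.of_forall fun x => ?_)
  rw [← ofReal_norm, ← ofReal_norm]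
  exact ENNReal.ofReal_le_ofReal (ℓ.le_of_opNorm_le_of_le hℓ le_rfl |>.trans (by simp))

namespace LorentzSpace

variable {α : Type*} [MeasurableSpace α] {p : ℝ} {q : ℝ≥0∞} [hq : Fact (1 ≤ q)] {μ : Measure α}
  [SFinite μ] {F : Type*} [NormedAddCommGroup F] [NormedSpace ℝ F]

/-- The class of a function with finite Lorentz norm. -/
def ofFun (f : α → F) (hf : AEStronglyMeasurable f μ) (h : lorentzENorm p q μ f < ⊤) :
    LorentzSpace p q μ F :=
  ⟨AEEqFun.mk f hf, by
    change lorentzENorm p q μ (AEEqFun.mk f hf) < ⊤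
    rwa [lorentzENorm_congr_ae (AEEqFun.coeFn_mk f hf)]⟩

theorem coeFn_ofFun (f : α → F) (hf : AEStronglyMeasurable f μ) (h : lorentzENorm p q μ f < ⊤) :
    (ofFun f hf h).1 =ᵐ[μ] f := AEEqFun.coeFn_mk f hf

theorem lorentzENorm_lt_top (v : LorentzSpace p q μ F) : lorentzENorm p q μ v.1 < ⊤ := v.2

theorem lorentzENorm_eq_enorm (v : LorentzSpace p q μ F) : lorentzENorm p q μ v.1 = ‖v‖ₑ := by
  rw [← ofReal_norm, norm_def, ENNReal.ofReal_toReal (lorentzENorm_lt_top v).ne]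

theorem lorentzENorm_eq_enorm_of_ae {v : LorentzSpace p q μ F} {f : α → F} (h : v.1 =ᵐ[μ] f) :
    lorentzENorm p q μ f = ‖v‖ₑ := by
  rw [← lorentzENorm_eq_enorm, lorentzENorm_congr_ae h]

theorem coeFn_sub (v w : LorentzSpace p q μ F) : (v - w).1 =ᵐ[μ] v.1 - w.1 := AEEqFun.coeFn_sub _ _

theorem lorentzENorm_sub_eq {v w : LorentzSpace p q μ F} {f g : α → F} (hv : v.1 =ᵐ[μ] f)
    (hw : w.1 =ᵐ[μ] g) : lorentzENorm p q μ (f - g) = ‖v - w‖ₑ :=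
  lorentzENorm_eq_enorm_of_ae ((coeFn_sub v w).trans (hv.sub hw))

end LorentzSpace

namespace LorentzSpace

variable {α : Type*} [MeasurableSpace α] {p : ℝ} {μ : Measure α} [SFinite μ]
  {F : Type*} [NormedAddCommGroup F] [NormedSpace ℝ F]

theorem norm_integral_mul_le {ℓ : F →L[ℝ] ℝ} (hℓ : ‖ℓ‖ ≤ 1) {ψ : α → ℝ} {C t : ℝ} {A : Set α}
    (hC0 : 0 ≤ C) (hC : ∀ x, |ψ x| ≤ C) (hA : ∀ x, x ∉ A → ψ x = 0) (ht : 0 < t)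
    (hμ : μ A ≤ ENNReal.ofReal t) (v : LorentzSpace p ⊤ μ F) :
    ‖∫ x, ψ x * ℓ (v.1 x) ∂μ‖ ≤ C * t ^ (1 - 1 / p) * ‖v‖ := by
  have hm : AEStronglyMeasurable (fun x => ℓ (v.1 x)) μ :=
    ℓ.continuous.comp_aestronglyMeasurable v.1.aestronglyMeasurable
  have h2 := (enorm_integral_mul_le_lorentzENorm_top (p := p) hm hC hA ht hμ).trans
    (mul_le_mul_right (mul_le_mul_right
    ((lorentzENorm_comp_clm_le hℓ _).trans_eq (lorentzENorm_eq_enorm v)) _) _)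
  rw [← ofReal_norm, ← ofReal_norm, ENNReal.ofReal_rpow_of_pos ht,
    ← ENNReal.ofReal_mul (by positivity), ← ENNReal.ofReal_mul hC0,
    ENNReal.ofReal_le_ofReal_iff (by positivity), ← mul_assoc] at h2
  exact h2

/-- The functional `f ↦ ∫ ψ ℓ(f)` on weak `L^p`, for a bounded `ψ` that vanishes off a set of
finite measure. -/
def pairing (hp : 1 < p) {ℓ : F →L[ℝ] ℝ} (hℓ : ‖ℓ‖ ≤ 1) {ψ : α → ℝ}
    (hψ : AEStronglyMeasurable ψ μ) {C t : ℝ} {A : Set α} (hC0 : 0 ≤ C) (hC : ∀ x, |ψ x| ≤ C)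
    (hA : ∀ x, x ∉ A → ψ x = 0) (ht : 0 < t) (hμ : μ A ≤ ENNReal.ofReal t) :
    StrongDual ℝ (LorentzSpace p ⊤ μ F) :=
  have hm : ∀ v : LorentzSpace p ⊤ μ F, AEStronglyMeasurable (fun x => ℓ (v.1 x)) μ := fun v =>
    ℓ.continuous.comp_aestronglyMeasurable v.1.aestronglyMeasurable
  have hint : ∀ v : LorentzSpace p ⊤ μ F, Integrable (fun x => ψ x * ℓ (v.1 x)) μ := fun v =>
    integrable_mul_of_lorentzENorm_top hp (hm v) hψ
      ((lorentzENorm_comp_clm_le hℓ _).trans_lt (lorentzENorm_lt_top v)) hC hA ht hμ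
  LinearMap.mkContinuous
    { toFun := fun v => ∫ x, ψ x * ℓ (v.1 x) ∂μ
      map_add' := fun v w => by
        rw [← integral_add (hint v) (hint w)]
        refine integral_congr_ae ?_
        filter_upwards [coeFn_add v w] with x hx
        rw [hx, Pi.add_apply, map_add, mul_add]
      map_smul' := fun c v => by
        rw [RingHom.id_apply, smul_eq_mul, ← integral_const_mul]
        refine integral_congr_ae ?_
        filter_upwards [coeFn_smul c v] with x hx
        rw [hx, Pi.smul_apply, map_smul, smul_eq_mul, mul_left_comm] }
    (C * t ^ (1 - 1 / p)) (norm_integral_mul_le hℓ hC0 hC hA ht hμ)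

theorem norm_pairing_le (hp : 1 < p) {ℓ : F →L[ℝ] ℝ} (hℓ : ‖ℓ‖ ≤ 1) {ψ : α → ℝ}
    (hψ : AEStronglyMeasurable ψ μ) {C t : ℝ} {A : Set α} (hC0 : 0 ≤ C) (hC : ∀ x, |ψ x| ≤ C)
    (hA : ∀ x, x ∉ A → ψ x = 0) (ht : 0 < t) (hμ : μ A ≤ ENNReal.ofReal t) :
    ‖pairing (F := F) hp hℓ hψ hC0 hC hA ht hμ‖ ≤ C * t ^ (1 - 1 / p) :=
  ContinuousLinearMap.opNorm_le_bound _ (by positivity) (norm_integral_mul_le hℓ hC0 hC hA ht hμ)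

end LorentzSpace

/-! ### Membership in H^{1,(p,q)} as approximation by smooth functions -/

section SmoothApproximation

variable {n : ℕ} {Ω : TopologicalSpace.Opens (EuclideanSpace ℝ (Fin n))}

/-- Makes the exponent r = min(p,q) harmless: approximating a pair amounts to approximating its two
components. -/
theorem WithLp.prod_norm_le_add {r : ℝ≥0∞} [Fact (1 ≤ r)] {X Y : Type*} [NormedAddCommGroup X]
    [NormedAddCommGroup Y] (w : WithLp r (X × Y)) : ‖w‖ ≤ ‖w.fst‖ + ‖w.snd‖ := by
  have h : w = WithLp.toLp r (w.fst, 0) + WithLp.toLp r (0, w.snd) := by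
    refine WithLp.ofLp_injective r ?_
    ext <;> simp
  calc ‖w‖ = ‖WithLp.toLp r (w.fst, (0 : Y)) + WithLp.toLp r ((0 : X), w.snd)‖ := by rw [← h]
    _ ≤ _ := norm_add_le _ _
    _ = _ := by rw [WithLp.norm_toLp_fst, WithLp.norm_toLp_snd]

theorem continuousOn_gradient {φ : EuclideanSpace ℝ (Fin n) → ℝ} (h : ContDiffOn ℝ ∞ φ Ω) :
    ContinuousOn (gradient φ) Ω :=
  (InnerProductSpace.toDual ℝ _).symm.continuous.comp_continuousOn
    (h.continuousOn_fderiv_of_isOpen Ω.isOpen (by simp))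

theorem aestronglyMeasurable_of_smoothOn {φ : EuclideanSpace ℝ (Fin n) → ℝ}
    (h : ContDiffOn ℝ ∞ φ Ω) : AEStronglyMeasurable φ (volume.restrict Ω) :=
  h.continuousOn.aestronglyMeasurable Ω.isOpen.measurableSet

theorem aestronglyMeasurable_gradient_of_smoothOn {φ : EuclideanSpace ℝ (Fin n) → ℝ}
    (h : ContDiffOn ℝ ∞ φ Ω) : AEStronglyMeasurable (gradient φ) (volume.restrict Ω) :=
  (continuousOn_gradient h).aestronglyMeasurable Ω.isOpen.measurableSet

/-- `(u, g)` is approximated by pairs `(φ, ∇φ)`, `φ ∈ C^∞(Ω)`, in the Lorentz norm. -/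
structure IsSmoothLimit (p : ℝ) (q : ℝ≥0∞) (Ω : TopologicalSpace.Opens (EuclideanSpace ℝ (Fin n)))
    (u : EuclideanSpace ℝ (Fin n) → ℝ) (g : EuclideanSpace ℝ (Fin n) → EuclideanSpace ℝ (Fin n)) :
    Prop where
  aesm_fst : AEStronglyMeasurable u (volume.restrict Ω)
  aesm_snd : AEStronglyMeasurable g (volume.restrict Ω)
  fst_lt_top : lorentzENorm p q (volume.restrict Ω) u < ⊤
  snd_lt_top : lorentzENorm p q (volume.restrict Ω) g < ⊤
  approx : ∀ δ : ℝ≥0∞, 0 < δ → ∃ φ : EuclideanSpace ℝ (Fin n) → ℝ, ContDiffOn ℝ ∞ φ Ω ∧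
    lorentzENorm p q (volume.restrict Ω) (u - φ) < δ ∧
    lorentzENorm p q (volume.restrict Ω) (g - gradient φ) < δ

variable {p : ℝ} {q : ℝ≥0∞} {u : EuclideanSpace ℝ (Fin n) → ℝ}
  {g : EuclideanSpace ℝ (Fin n) → EuclideanSpace ℝ (Fin n)}

/-- Points are null once n ≥ 1, so all norms on Ω and on Ω \ {y} coincide; only the smoothness
requirement differs. -/
theorem restrict_puncture (hn : 1 ≤ n) (y : EuclideanSpace ℝ (Fin n)) :
    volume.restrict (puncture Ω y : Set (EuclideanSpace ℝ (Fin n))) =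
      volume.restrict (Ω : Set (EuclideanSpace ℝ (Fin n))) := by
  have : Nonempty (Fin n) := ⟨⟨0, hn⟩⟩
  exact Measure.restrict_congr_set (sdiff_null_ae_eq_self (measure_singleton y))

theorem IsSmoothLimit.puncture (hn : 1 ≤ n) (h : IsSmoothLimit p q Ω u g)
    (y : EuclideanSpace ℝ (Fin n)) : IsSmoothLimit p q (puncture Ω y) u g := by
  obtain ⟨h1, h2, h3, h4, h5⟩ := h
  constructor
  all_goals rw [restrict_puncture hn]
  · exact h1
  · exact h2
  · exact h3
  · exact h4
  · intro δ hδ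
    obtain ⟨φ, hφ, h6⟩ := h5 δ hδ
    exact ⟨φ, hφ.mono sdiff_subset, h6⟩

variable [hq : Fact (1 ≤ q)]

/-- An approximant of finite distance from a function of finite norm has finite norm itself, which
is why `IsSmoothLimit.approx` need not demand it. -/
theorem lorentzENorm_lt_top_of_sub {α F : Type*} [MeasurableSpace α] {μ : Measure α} [SFinite μ]
    [NormedAddCommGroup F] {f h : α → F} (hf : AEStronglyMeasurable f μ)
    (hh : AEStronglyMeasurable h μ) (h1 : lorentzENorm p q μ f < ⊤)
    (h2 : lorentzENorm p q μ (f - h) < ⊤) : lorentzENorm p q μ h < ⊤ := by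
  have h3 : lorentzENorm p q μ (h - f) = lorentzENorm p q μ (f - h) :=
    lorentzENorm_congr_enorm (.of_forall fun x => by
      simp only [Pi.sub_apply]; rw [← enorm_neg, neg_sub])
  have h4 := lorentzENorm_add_le (p := p) hq.out hf (hh.sub hf)
  rw [add_sub_cancel, h3] at h4
  exact h4.trans_lt (ENNReal.add_lt_top.2 ⟨h1, h2⟩)

theorem isSmoothLimit_gradient (hu : ContDiffOn ℝ ∞ u Ω)
    (h1 : lorentzENorm p q (volume.restrict Ω) u < ⊤)
    (h2 : lorentzENorm p q (volume.restrict Ω) (gradient u) < ⊤) :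
    IsSmoothLimit p q Ω u (gradient u) where
  aesm_fst := aestronglyMeasurable_of_smoothOn hu
  aesm_snd := aestronglyMeasurable_gradient_of_smoothOn hu
  fst_lt_top := h1
  snd_lt_top := h2
  approx := fun δ hδ => ⟨u, hu, by
    rwa [sub_self, lorentzENorm_zero hq.out], by rwa [sub_self, lorentzENorm_zero hq.out]⟩

variable [hp : Fact (1 < p)]

theorem isSmoothLimit_of_mem {w : LorentzPair p q Ω} (hw : w ∈ SobolevLorentzH p q Ω)
    (hu : u =ᵐ[volume.restrict Ω] w.fst.1) : IsSmoothLimit p q Ω u w.snd.1 where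
  aesm_fst := w.fst.1.aestronglyMeasurable.congr hu.symm
  aesm_snd := w.snd.1.aestronglyMeasurable
  fst_lt_top := by
    rw [lorentzENorm_congr_ae hu]
    exact LorentzSpace.lorentzENorm_lt_top w.fst
  snd_lt_top := LorentzSpace.lorentzENorm_lt_top w.snd
  approx := fun δ hδ => by
    obtain ⟨v, ⟨φ, hφ, h1, h2⟩, hv⟩ := EMetric.mem_closure_iff.1 hw δ hδ
    rw [edist_eq_enorm_sub] at hv
    refine ⟨φ, hφ, ?_, ?_⟩
    · rw [LorentzSpace.lorentzENorm_sub_eq hu.symm h1]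
      exact (WithLp.enorm_fst_le _ (w - v)).trans_lt hv
    · rw [LorentzSpace.lorentzENorm_sub_eq (EventuallyEq.refl _ _) h2]
      exact (WithLp.enorm_snd_le _ (w - v)).trans_lt hv

theorem exists_isSmoothLimit_of_mem_funH (hu : u ∈ funH p q Ω) :
    ∃ g, IsSmoothLimit p q Ω u g := by
  obtain ⟨w, hw, hwu⟩ := hu
  exact ⟨_, isSmoothLimit_of_mem hw hwu⟩

theorem IsSmoothLimit.mem_funH (h : IsSmoothLimit p q Ω u g) : u ∈ funH p q Ω := by
  set w : LorentzPair p q Ω := WithLp.toLp _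
    (LorentzSpace.ofFun u h.aesm_fst h.fst_lt_top, LorentzSpace.ofFun g h.aesm_snd h.snd_lt_top)
    with hw
  have hw1 : w.fst.1 =ᵐ[volume.restrict Ω] u :=
    LorentzSpace.coeFn_ofFun u h.aesm_fst h.fst_lt_top
  have hw2 : w.snd.1 =ᵐ[volume.restrict Ω] g :=
    LorentzSpace.coeFn_ofFun g h.aesm_snd h.snd_lt_top
  refine ⟨w, EMetric.mem_closure_iff.2 fun δ hδ => ?_, hw1.symm⟩
  obtain ⟨δ', hδ', hδδ⟩ : ∃ δ' : ℝ≥0∞, 0 < δ' ∧ δ' ≤ min 1 (δ / 2) :=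
    ⟨min 1 (δ / 2), by simpa using hδ.ne', le_rfl⟩
  obtain ⟨φ, hφ, h1, h2⟩ := h.approx δ' hδ'
  have htop : ∀ {a : ℝ≥0∞}, a < δ' → a < ⊤ := fun ha => ha.trans_le le_top
  have hφ1 := lorentzENorm_lt_top_of_sub h.aesm_fst (aestronglyMeasurable_of_smoothOn hφ)
    h.fst_lt_top (htop h1)
  have hφ2 := lorentzENorm_lt_top_of_sub h.aesm_snd (aestronglyMeasurable_gradient_of_smoothOn hφ)
    h.snd_lt_top (htop h2)
  set v : LorentzPair p q Ω := WithLp.toLp _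
    (LorentzSpace.ofFun φ (aestronglyMeasurable_of_smoothOn hφ) hφ1,
      LorentzSpace.ofFun (gradient φ) (aestronglyMeasurable_gradient_of_smoothOn hφ) hφ2) with hv
  have hv1 : v.fst.1 =ᵐ[volume.restrict Ω] φ :=
    LorentzSpace.coeFn_ofFun φ (aestronglyMeasurable_of_smoothOn hφ) hφ1
  have hv2 : v.snd.1 =ᵐ[volume.restrict Ω] gradient φ :=
    LorentzSpace.coeFn_ofFun (gradient φ) (aestronglyMeasurable_gradient_of_smoothOn hφ) hφ2
  refine ⟨v, ⟨φ, hφ, hv1, hv2⟩, ?_⟩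
  rw [LorentzSpace.lorentzENorm_sub_eq hw1 hv1] at h1
  rw [LorentzSpace.lorentzENorm_sub_eq hw2 hv2] at h2
  have hle : ‖w - v‖ₑ ≤ ‖w.fst - v.fst‖ₑ + ‖w.snd - v.snd‖ₑ := by
    simp only [← ofReal_norm]
    rw [← ENNReal.ofReal_add (norm_nonneg _) (norm_nonneg _)]
    exact ENNReal.ofReal_le_ofReal (WithLp.prod_norm_le_add (w - v))
  rw [edist_eq_enorm_sub]
  calc _ ≤ _ := hle
    _ < δ' + δ' := ENNReal.add_lt_add h1 h2
    _ ≤ δ / 2 + δ / 2 := add_le_add (hδδ.trans (min_le_right _ _)) (hδδ.trans (min_le_right _ _))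
    _ = δ := ENNReal.add_halves δ

/-- The same approximants serve, by the embedding of L^{(p,q)} into weak L^p; this yields the
inclusion in (ii). -/
theorem IsSmoothLimit.to_top (h : IsSmoothLimit p q Ω u g) (hqt : q ≠ ⊤) :
    IsSmoothLimit p ⊤ Ω u g := by
  have hp0 : 0 < p := zero_lt_one.trans hp.out
  set K : ℝ≥0∞ := 2 * 2 ^ (1 / q.toReal) with hK
  have hKtop : K ≠ ⊤ := ENNReal.mul_ne_top (by simp)
    (ENNReal.rpow_ne_top_of_nonneg (by positivity) (by simp))
  have hK0 : K ≠ 0 := mul_ne_zero (by simp) (ENNReal.rpow_pos (by simp) (by simp)).ne'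
  refine ⟨h.aesm_fst, h.aesm_snd, (lorentzENorm_top_le hp0 hq.out hqt _).trans_lt
    (ENNReal.mul_lt_top hKtop.lt_top h.fst_lt_top),
    (lorentzENorm_top_le hp0 hq.out hqt _).trans_lt
    (ENNReal.mul_lt_top hKtop.lt_top h.snd_lt_top), fun δ hδ => ?_⟩
  obtain ⟨φ, hφ, h1, h2⟩ := h.approx (δ / K) (ENNReal.div_pos hδ.ne' hKtop)
  refine ⟨φ, hφ, (lorentzENorm_top_le hp0 hq.out hqt _).trans_lt ?_,
    (lorentzENorm_top_le hp0 hq.out hqt _).trans_lt ?_⟩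
  · rwa [← hK, mul_comm, ← ENNReal.lt_div_iff_mul_lt (Or.inl hK0) (Or.inl hKtop)]
  · rwa [← hK, mul_comm, ← ENNReal.lt_div_iff_mul_lt (Or.inl hK0) (Or.inl hKtop)]

end SmoothApproximation

/-! ### Weak derivatives of limits of smooth functions -/

section WeakDerivatives

variable {n : ℕ} {Ω : TopologicalSpace.Opens (EuclideanSpace ℝ (Fin n))} {i : Fin n}
  {φ ψ u v : EuclideanSpace ℝ (Fin n) → ℝ} {p : ℝ}
  {g : EuclideanSpace ℝ (Fin n) → EuclideanSpace ℝ (Fin n)}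

theorem gradient_apply (φ : EuclideanSpace ℝ (Fin n) → ℝ) (x : EuclideanSpace ℝ (Fin n))
    (i : Fin n) : gradient φ x i = fderiv ℝ φ x (EuclideanSpace.single i 1) := by
  have h : inner ℝ (gradient φ x) (EuclideanSpace.single i 1) =
      fderiv ℝ φ x (EuclideanSpace.single i 1) := by
    rw [gradient, InnerProductSpace.toDual_symm_apply]
  rw [EuclideanSpace.inner_single_right] at h
  simpa using h

theorem norm_gradient (φ : EuclideanSpace ℝ (Fin n) → ℝ) (x : EuclideanSpace ℝ (Fin n)) :
    ‖gradient φ x‖ = ‖fderiv ℝ φ x‖ := by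
  rw [gradient, LinearIsometryEquiv.norm_map]

theorem norm_proj_le_one (i : Fin n) :
    ‖(EuclideanSpace.proj i : EuclideanSpace ℝ (Fin n) →L[ℝ] ℝ)‖ ≤ 1 :=
  ContinuousLinearMap.opNorm_le_bound _ zero_le_one fun x => by
    simpa using PiLp.norm_apply_le x i

theorem locallyIntegrableOn_of_lorentzENorm_top (hp : 1 < p)
    (hu : AEStronglyMeasurable u (volume.restrict Ω))
    (h : lorentzENorm p ⊤ (volume.restrict Ω) u < ⊤) : LocallyIntegrableOn u Ω := by
  intro x hx
  refine ⟨Metric.ball x 1 ∩ Ω, inter_mem (mem_nhdsWithin_of_mem_nhds (Metric.ball_mem_nhds x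
    one_pos)) self_mem_nhdsWithin, ?_⟩
  have hm : MeasurableSet (Metric.ball x 1) := Metric.isOpen_ball.measurableSet
  have hμ : volume.restrict (Ω : Set (EuclideanSpace ℝ (Fin n))) (Metric.ball x 1) ≤
      ENNReal.ofReal ((volume (Metric.ball x 1)).toReal + 1) :=
    (Measure.restrict_apply_le _ _).trans ((ENNReal.ofReal_toReal
      measure_ball_lt_top.ne).symm.trans_le (ENNReal.ofReal_le_ofReal (by linarith)))
  have := integrable_mul_of_lorentzENorm_top hp (ψ := (Metric.ball x 1).indicator 1) hu
    ((measurable_one.indicator hm).aestronglyMeasurable) h (C := 1) (A := Metric.ball x 1)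
    (fun z => by by_cases hz : z ∈ Metric.ball x 1 <;> simp only [hz, indicator_of_mem,
      indicator_of_notMem, not_false_eq_true, Pi.one_apply, abs_one, abs_zero, le_refl,
      zero_le_one])
    (fun z hz => indicator_of_notMem hz _) (by positivity) hμ
  have h2 : (fun z => (Metric.ball x 1).indicator 1 z * u z) = (Metric.ball x 1).indicator u := by
    ext z
    by_cases hz : z ∈ Metric.ball x 1 <;> simp only [hz, indicator_of_mem,
      indicator_of_notMem, not_false_eq_true, Pi.one_apply, one_mul, zero_mul]
  rw [h2, integrable_indicator_iff hm, IntegrableOn, Measure.restrict_restrict hm] at this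
  exact this

theorem tsupport_fderiv_subset_of_tsupport (hs : tsupport ψ ⊆ Ω) :
    tsupport (fun x => fderiv ℝ ψ x (EuclideanSpace.single i 1)) ⊆ Ω :=
  (tsupport_fderiv_apply_subset ℝ _).trans hs

/-- Although φ is smooth only on Ω, both integrands live on the support of ψ inside Ω. The integrals
thus extend to the whole space, where integration by parts requires φ to be differentiable only on
that support. -/
theorem setIntegral_mul_fderiv (hφ : ContDiffOn ℝ ∞ φ Ω) (hψ : ContDiff ℝ ∞ ψ)
    (hc : HasCompactSupport ψ) (hs : tsupport ψ ⊆ Ω) :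
    ∫ x in Ω, ψ x * fderiv ℝ φ x (EuclideanSpace.single i 1) =
      -∫ x in Ω, fderiv ℝ ψ x (EuclideanSpace.single i 1) * φ x := by
  have hfull : ∀ {a b : EuclideanSpace ℝ (Fin n) → ℝ}, tsupport a ⊆ Ω →
      ∀ x, x ∉ (Ω : Set (EuclideanSpace ℝ (Fin n))) → a x * b x = 0 := fun ha x hx => by
    rw [image_eq_zero_of_notMem_tsupport fun h => hx (ha h), zero_mul]
  have hfull' : ∀ {a b : EuclideanSpace ℝ (Fin n) → ℝ}, tsupport a ⊆ Ω →
      Function.support (fun x => a x * b x) ⊆ Ω := fun ha x hx => by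
    by_contra hxΩ
    exact hx (hfull ha x hxΩ)
  have hs' := tsupport_fderiv_subset_of_tsupport (i := i) hs
  have hc' : HasCompactSupport fun x => fderiv ℝ ψ x (EuclideanSpace.single i 1) :=
    hc.fderiv_apply ℝ _
  have hψ' : Continuous fun x => fderiv ℝ ψ x (EuclideanSpace.single i 1) :=
    (hψ.continuous_fderiv (by simp)).clm_apply continuous_const
  have hφ1 : LocallyIntegrableOn φ Ω :=
    hφ.continuousOn.locallyIntegrableOn Ω.isOpen.measurableSet
  have hφ2 : LocallyIntegrableOn (fun x => fderiv ℝ φ x (EuclideanSpace.single i 1)) Ω :=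
    ((hφ.continuousOn_fderiv_of_isOpen Ω.isOpen (by simp)).clm_apply
      continuousOn_const).locallyIntegrableOn Ω.isOpen.measurableSet
  rw [setIntegral_eq_integral_of_forall_compl_eq_zero (hfull hs),
    setIntegral_eq_integral_of_forall_compl_eq_zero (hfull hs')]
  refine integral_mul_fderiv_eq_neg_fderiv_mul_of_integrable ?_ ?_ ?_
    (fun x _ => hψ.differentiable (by simp) x)
    (fun x hx => differentiableAt_of_smoothOn hφ (hs hx))
  · exact (integrableOn_iff_integrable_of_support_subset (hfull' hs')).1
      (integrableOn_mul_of_locallyIntegrableOn hφ1 hψ' hc' hs')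
  · exact (integrableOn_iff_integrable_of_support_subset (hfull' hs)).1
      (integrableOn_mul_of_locallyIntegrableOn hφ2 hψ.continuous hc hs)
  · exact (integrableOn_iff_integrable_of_support_subset (hfull' hs)).1
      (integrableOn_mul_of_locallyIntegrableOn hφ1 hψ.continuous hc hs)

theorem isWeakPartial_of_smoothOn (hφ : ContDiffOn ℝ ∞ φ Ω) :
    IsWeakPartial Ω i φ fun x => fderiv ℝ φ x (EuclideanSpace.single i 1) :=
  ⟨hφ.continuousOn.locallyIntegrableOn Ω.isOpen.measurableSet,
    ((hφ.continuousOn_fderiv_of_isOpen Ω.isOpen (by simp)).clm_apply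
      continuousOn_const).locallyIntegrableOn Ω.isOpen.measurableSet,
    fun _ hψ hc hs => setIntegral_mul_fderiv hφ hψ hc hs⟩

/-- Pairing with a compactly supported function is continuous in the weak `L^p` norm. -/
theorem exists_enorm_setIntegral_mul_le (hp : 1 < p) (hψ : Continuous ψ)
    (hc : HasCompactSupport ψ) : ∃ K : ℝ≥0∞, K ≠ ⊤ ∧ ∀ f : EuclideanSpace ℝ (Fin n) → ℝ,
      AEStronglyMeasurable f (volume.restrict Ω) →
      ‖∫ x in Ω, ψ x * f x‖ₑ ≤ K * lorentzENorm p ⊤ (volume.restrict Ω) f := by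
  obtain ⟨C, hC⟩ := hψ.bounded_above_of_compact_support hc
  have hp1 : 1 / p < 1 := by rw [div_lt_one (by linarith)]; exact hp
  -- The summand 1 keeps t positive even when the support is null.
  set t : ℝ := (volume (tsupport ψ)).toReal + 1
  have ht : 0 < t := by positivity
  refine ⟨ENNReal.ofReal C * ENNReal.ofReal t ^ (1 - 1 / p), ENNReal.mul_ne_top
    ENNReal.ofReal_ne_top (ENNReal.rpow_ne_top_of_nonneg (by linarith) ENNReal.ofReal_ne_top),
    fun f hf => ?_⟩
  rw [mul_assoc]
  refine enorm_integral_mul_le_lorentzENorm_top hf hC (A := tsupport ψ)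
    (fun x hx => image_eq_zero_of_notMem_tsupport hx) ht ?_
  exact (Measure.restrict_apply_le _ _).trans ((ENNReal.ofReal_toReal
    hc.isCompact.measure_lt_top.ne).symm.trans_le (ENNReal.ofReal_le_ofReal (by simp [t])))

theorem lorentzENorm_apply_le {q : ℝ≥0∞} {μ : Measure (EuclideanSpace ℝ (Fin n))}
    (g : EuclideanSpace ℝ (Fin n) → EuclideanSpace ℝ (Fin n)) (i : Fin n) :
    lorentzENorm p q μ (fun x => g x i) ≤ lorentzENorm p q μ g :=
  lorentzENorm_comp_clm_le (norm_proj_le_one i) g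

theorem aestronglyMeasurable_apply {μ : Measure (EuclideanSpace ℝ (Fin n))}
    (hg : AEStronglyMeasurable g μ) (i : Fin n) : AEStronglyMeasurable (fun x => g x i) μ :=
  (EuclideanSpace.proj (𝕜 := ℝ) i).continuous.comp_aestronglyMeasurable hg

/-- For a fixed test function both sides of the integration-by-parts identity are continuous in the
weak L^p norm, so the identity passes from smooth functions to their limits. -/
theorem IsSmoothLimit.isWeakPartial (hp : 1 < p) (h : IsSmoothLimit p ⊤ Ω u g) (i : Fin n) :
    IsWeakPartial Ω i u fun x => g x i := by
  have hgm := aestronglyMeasurable_apply h.aesm_snd i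
  have hu := locallyIntegrableOn_of_lorentzENorm_top hp h.aesm_fst h.fst_lt_top
  have hg := locallyIntegrableOn_of_lorentzENorm_top hp hgm
    ((lorentzENorm_apply_le g i).trans_lt h.snd_lt_top)
  refine ⟨hu, hg, fun ψ hψ hc hs => ?_⟩
  have hs' := tsupport_fderiv_subset_of_tsupport (i := i) hs
  have hc' : HasCompactSupport fun x => fderiv ℝ ψ x (EuclideanSpace.single i 1) :=
    hc.fderiv_apply ℝ _
  have hψ' : Continuous fun x => fderiv ℝ ψ x (EuclideanSpace.single i 1) :=
    (hψ.continuous_fderiv (by simp)).clm_apply continuous_const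
  obtain ⟨K, hK, hKle⟩ := exists_enorm_setIntegral_mul_le (Ω := Ω) hp hψ.continuous hc
  obtain ⟨K', hK', hKle'⟩ := exists_enorm_setIntegral_mul_le (Ω := Ω) hp hψ' hc'
  rw [← sub_eq_zero, sub_neg_eq_add, ← enorm_eq_zero, ← nonpos_iff_eq_zero]
  refine le_of_forall_pos_le_add fun δ hδ => ?_
  rw [zero_add]
  have hS : K + K' ≠ ⊤ := ENNReal.add_ne_top.2 ⟨hK, hK'⟩
  -- If `K + K' = 0` the tolerance is `⊤`; since `0 * ⊤ = 0`, the final bound by δ still holds, as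
  -- an inequality.
  obtain ⟨φ, hφ, h1, h2⟩ := h.approx (δ / (K + K')) (ENNReal.div_pos hδ.ne' hS)
  have hφw := isWeakPartial_of_smoothOn (i := i) hφ
  have e1 : ∫ x in Ω, ψ x * g x i = (∫ x in Ω, ψ x * (g - gradient φ) x i) +
      ∫ x in Ω, ψ x * fderiv ℝ φ x (EuclideanSpace.single i 1) := by
    have hi1 := integrableOn_mul_of_locallyIntegrableOn hg hψ.continuous hc hs
    have hi2 := integrableOn_mul_of_locallyIntegrableOn hφw.2.1 hψ.continuous hc hs
    rw [← sub_eq_iff_eq_add, ← integral_sub hi1 hi2]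
    congr 1 with x
    rw [← gradient_apply, Pi.sub_apply, PiLp.sub_apply, mul_sub]
  have e2 : ∫ x in Ω, fderiv ℝ ψ x (EuclideanSpace.single i 1) * u x =
      (∫ x in Ω, fderiv ℝ ψ x (EuclideanSpace.single i 1) * (u - φ) x) +
      ∫ x in Ω, fderiv ℝ ψ x (EuclideanSpace.single i 1) * φ x := by
    have hi1 := integrableOn_mul_of_locallyIntegrableOn hu hψ' hc' hs'
    have hi2 := integrableOn_mul_of_locallyIntegrableOn hφw.1 hψ' hc' hs'
    rw [← sub_eq_iff_eq_add, ← integral_sub hi1 hi2]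
    congr 1 with x
    rw [Pi.sub_apply, mul_sub]
  rw [e1, e2, hφw.2.2 ψ hψ hc hs, add_add_add_comm, neg_add_cancel, add_zero]
  refine (enorm_add_le _ _).trans ?_
  calc _ ≤ K * (δ / (K + K')) + K' * (δ / (K + K')) := by
        refine add_le_add ((hKle _ (aestronglyMeasurable_apply (h.aesm_snd.sub
          (aestronglyMeasurable_gradient_of_smoothOn hφ)) i)).trans ?_) ((hKle' _
          (h.aesm_fst.sub (aestronglyMeasurable_of_smoothOn hφ))).trans ?_)
        · gcongr
          exact (lorentzENorm_apply_le _ i).trans h2.le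
        · gcongr
    _ = (K + K') * (δ / (K + K')) := by rw [add_mul]
    _ ≤ δ := ENNReal.mul_div_le

theorem mem_funW_of_isWeakPartial {q : ℝ≥0∞} [Fact (1 ≤ q)]
    (hu : AEStronglyMeasurable u (volume.restrict Ω))
    (hg : AEStronglyMeasurable g (volume.restrict Ω))
    (h1 : lorentzENorm p q (volume.restrict Ω) u < ⊤)
    (h2 : lorentzENorm p q (volume.restrict Ω) g < ⊤)
    (h : ∀ i, IsWeakPartial Ω i u fun x => g x i) : u ∈ funW p q Ω := by
  have hgm := fun i => aestronglyMeasurable_apply hg i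
  have hgt := fun i => (lorentzENorm_apply_le g i).trans_lt h2
  refine ⟨WithLp.toLp 1 (LorentzSpace.ofFun u hu h1, WithLp.toLp 1 fun i =>
    LorentzSpace.ofFun (fun x => g x i) (hgm i) (hgt i)), fun i => ?_, ?_⟩
  · exact (h i).congr (LorentzSpace.coeFn_ofFun u hu h1).symm
      (LorentzSpace.coeFn_ofFun (fun x => g x i) (hgm i) (hgt i)).symm
  · exact (LorentzSpace.coeFn_ofFun u hu h1).symm

theorem IsSmoothLimit.mem_funW (hp : 1 < p) (h : IsSmoothLimit p ⊤ Ω u g) : u ∈ funW p ⊤ Ω :=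
  mem_funW_of_isWeakPartial h.aesm_fst h.aesm_snd h.fst_lt_top h.snd_lt_top (h.isWeakPartial hp)

end WeakDerivatives

/-! ### Dilations, annular bumps and their scaling -/

section Dilation

variable {n : ℕ}

/-- The function `x ↦ h ((x - y) / r)`. -/
def dilate (y : EuclideanSpace ℝ (Fin n)) (r : ℝ) (h : EuclideanSpace ℝ (Fin n) → ℝ)
    (x : EuclideanSpace ℝ (Fin n)) : ℝ :=
  h (r⁻¹ • (x - y))

/-- The closed annulus `r ≤ |x - y| ≤ 3r`. -/
def annulus (y : EuclideanSpace ℝ (Fin n)) (r : ℝ) : Set (EuclideanSpace ℝ (Fin n)) :=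
  {x | r ≤ dist x y ∧ dist x y ≤ 3 * r}

variable {y : EuclideanSpace ℝ (Fin n)} {r : ℝ} {h : EuclideanSpace ℝ (Fin n) → ℝ}

theorem isClosed_annulus : IsClosed (annulus y r) :=
  (isClosed_le (f := fun _ => r) (g := fun x => dist x y) (by fun_prop) (by fun_prop)).inter
    (isClosed_le (f := fun x => dist x y) (g := fun _ => 3 * r) (by fun_prop) (by fun_prop))

theorem contDiff_dilate (hh : ContDiff ℝ ∞ h) : ContDiff ℝ ∞ (dilate y r h) :=
  hh.comp (contDiff_const_smul (r⁻¹) |>.comp (contDiff_id.sub contDiff_const))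

theorem fderiv_dilate (hh : ContDiff ℝ ∞ h) (x : EuclideanSpace ℝ (Fin n)) :
    fderiv ℝ (dilate y r h) x = r⁻¹ • fderiv ℝ h (r⁻¹ • (x - y)) := by
  have h1 : HasFDerivAt (fun x : EuclideanSpace ℝ (Fin n) => r⁻¹ • (x - y))
      (r⁻¹ • ContinuousLinearMap.id ℝ _) x := ((hasFDerivAt_id x).sub_const y).const_smul r⁻¹
  have h2 := ((hh.differentiable (by simp) (r⁻¹ • (x - y))).hasFDerivAt.comp x h1).fderiv
  change fderiv ℝ (h ∘ fun x => r⁻¹ • (x - y)) x = _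
  rw [h2]
  ext v
  simp

theorem integral_dilate (hr : 0 < r) : ∫ x, dilate y r h x = r ^ n * ∫ x, h x := by
  unfold dilate
  rw [integral_sub_right_eq_self (fun x => h (r⁻¹ • x)) y, Measure.integral_comp_inv_smul,
    finrank_euclideanSpace_fin, abs_of_pos (by positivity), smul_eq_mul]

theorem tsupport_dilate_subset (hr : 0 < r)
    (hh : ∀ z, h z ≠ 0 → 1 ≤ ‖z‖ ∧ ‖z‖ ≤ 3) : tsupport (dilate y r h) ⊆ annulus y r := by
  refine closure_minimal (fun x hx => ?_) isClosed_annulus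
  have h1 := hh _ hx
  rw [norm_smul, norm_inv, Real.norm_of_nonneg hr.le, ← dist_eq_norm, inv_mul_eq_div,
    le_div_iff₀ hr, div_le_iff₀ hr, one_mul] at h1
  exact h1

theorem annulus_subset_closedBall : annulus y r ⊆ Metric.closedBall y (3 * r) := fun _ hx => hx.2

/-- Volumes are measured on this open ball; any factor above 3 would do. -/
theorem annulus_subset_ball (hr : 0 < r) : annulus y r ⊆ Metric.ball y (4 * r) := fun x hx => by
  have := hx.2
  rw [Metric.mem_ball]
  linarith

theorem ne_of_mem_annulus (hr : 0 < r) {x : EuclideanSpace ℝ (Fin n)} (hx : x ∈ annulus y r) :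
    x ≠ y := by
  rintro rfl
  have := hx.1
  rw [dist_self] at this
  linarith

end Dilation

section Bump

variable {n : ℕ} (i : Fin n)

/-- A bump function supported in the annulus `1 ≤ |z| ≤ 3`. -/
def annulusBump : ContDiffBump (EuclideanSpace.single i (2 : ℝ)) where
  rIn := 1 / 2
  rOut := 1
  rIn_pos := by norm_num
  rIn_lt_rOut := by norm_num

/-- The bump function multiplied by a coordinate. -/
def coordBump (z : EuclideanSpace ℝ (Fin n)) : ℝ := z i * annulusBump i z

theorem contDiff_annulusBump : ContDiff ℝ ∞ (annulusBump i) := (annulusBump i).contDiff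

theorem contDiff_coordBump : ContDiff ℝ ∞ (coordBump i) :=
  ((EuclideanSpace.proj (𝕜 := ℝ) i).contDiff).mul (contDiff_annulusBump i)

/-- The support of the bump is the unit ball about 2 e_i, a point of norm 2. -/
theorem norm_of_annulusBump_ne_zero (z : EuclideanSpace ℝ (Fin n)) (hz : annulusBump i z ≠ 0) :
    1 ≤ ‖z‖ ∧ ‖z‖ ≤ 3 := by
  have h1 : z ∈ Metric.ball (EuclideanSpace.single i (2 : ℝ)) 1 :=
    (annulusBump i).support_eq ▸ (show z ∈ Function.support (annulusBump i) from hz)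
  rw [mem_ball_iff_norm] at h1
  have h2 : ‖EuclideanSpace.single i (2 : ℝ)‖ = 2 := by simp
  have h3 := abs_norm_sub_norm_le z (EuclideanSpace.single i (2 : ℝ))
  rw [h2] at h3
  have h4 := abs_le.1 (h3.trans h1.le)
  constructor <;> linarith [h4.1, h4.2]

theorem norm_of_coordBump_ne_zero (z : EuclideanSpace ℝ (Fin n)) (hz : coordBump i z ≠ 0) :
    1 ≤ ‖z‖ ∧ ‖z‖ ≤ 3 :=
  norm_of_annulusBump_ne_zero i z (right_ne_zero_of_mul hz)

theorem hasCompactSupport_annulusBump : HasCompactSupport (annulusBump i) :=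
  (annulusBump i).hasCompactSupport

theorem hasCompactSupport_coordBump : HasCompactSupport (coordBump i) :=
  (hasCompactSupport_annulusBump i).mul_left

/-- With ψ = z_i η, integration by parts gives ∫ ψ ∂_i η = -∫ η² - ∫ ψ ∂_i η, so the value is -½ ∫
η². The factor z_i is essential: ∫ η ∂_i η vanishes. -/
theorem integral_coordBump_mul_fderiv_ne_zero :
    ∫ z, coordBump i z * fderiv ℝ (annulusBump i) z (EuclideanSpace.single i 1) ≠ 0 := by
  set e : EuclideanSpace ℝ (Fin n) := EuclideanSpace.single i 1 with he
  have hη := contDiff_annulusBump i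
  have hηc := hasCompactSupport_annulusBump i
  have hη' : Continuous fun z => fderiv ℝ (annulusBump i) z e :=
    (hη.continuous_fderiv (by simp)).clm_apply continuous_const
  have hψ' : Continuous fun z => fderiv ℝ (coordBump i) z e :=
    ((contDiff_coordBump i).continuous_fderiv (by simp)).clm_apply continuous_const
  have hψf : ∀ z, fderiv ℝ (coordBump i) z e =
      annulusBump i z + z i * fderiv ℝ (annulusBump i) z e := fun z => by
    have h1 : HasFDerivAt (fun z : EuclideanSpace ℝ (Fin n) => z i)
        (EuclideanSpace.proj i : EuclideanSpace ℝ (Fin n) →L[ℝ] ℝ) z :=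
      (EuclideanSpace.proj (𝕜 := ℝ) i).hasFDerivAt
    have h2 := (h1.mul (hη.differentiable (by simp) z).hasFDerivAt).fderiv
    change fderiv ℝ ((fun z => z i) * ⇑(annulusBump i)) z e = _
    rw [h2]
    simp [he, add_comm]
  have i1 : Integrable fun z => coordBump i z * fderiv ℝ (annulusBump i) z e :=
    ((contDiff_coordBump i).continuous.mul hη').integrable_of_hasCompactSupport
      (hasCompactSupport_coordBump i).mul_right
  have i2 : Integrable fun z => fderiv ℝ (coordBump i) z e * annulusBump i z :=
    (hψ'.mul hη.continuous).integrable_of_hasCompactSupport hηc.mul_left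
  have i3 : Integrable fun z => coordBump i z * annulusBump i z :=
    ((contDiff_coordBump i).continuous.mul hη.continuous).integrable_of_hasCompactSupport
      hηc.mul_left
  have i4 : Integrable fun z => annulusBump i z * annulusBump i z :=
    (hη.continuous.mul hη.continuous).integrable_of_hasCompactSupport hηc.mul_left
  have h1 := integral_mul_fderiv_eq_neg_fderiv_mul_of_integrable i2 i1 i3
    (fun z _ => (contDiff_coordBump i).differentiable (by simp) z)
    (fun z _ => hη.differentiable (by simp) z)
  have h2 : ∫ z, fderiv ℝ (coordBump i) z e * annulusBump i z =
      (∫ z, annulusBump i z * annulusBump i z) +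
        ∫ z, coordBump i z * fderiv ℝ (annulusBump i) z e := by
    rw [← integral_add i4 i1]
    refine integral_congr_ae (.of_forall fun z => ?_)
    simp only [hψf, coordBump]
    ring
  have h3 : 0 < ∫ z, annulusBump i z * annulusBump i z := by
    refine (hη.continuous.mul hη.continuous).integral_pos_of_hasCompactSupport_nonneg_nonzero
      hηc.mul_left (fun z => mul_self_nonneg _) (x := EuclideanSpace.single i 2) ?_
    have : annulusBump i (EuclideanSpace.single i 2) = 1 :=
      (annulusBump i).one_of_mem_closedBall (Metric.mem_closedBall_self (annulusBump i).rIn_pos.le)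
    rw [this]
    norm_num
  intro h0
  rw [h2, h0] at h1
  linarith

end Bump

section ConcentratingBump

variable {n : ℕ} {p : ℝ} {i : Fin n} {y : EuclideanSpace ℝ (Fin n)} {r : ℝ}

/-- The bump `r^{1 - n/p} η((x - y)/r)`, whose gradient has a weak `L^p` norm independent of `r`. -/
def concBump (p : ℝ) (i : Fin n) (y : EuclideanSpace ℝ (Fin n)) (r : ℝ) :
    EuclideanSpace ℝ (Fin n) → ℝ :=
  r ^ (1 - n / p : ℝ) • dilate y r (annulusBump i)

/-- The weight against which the gradient of the bump is tested. -/
def concWeight (p : ℝ) (i : Fin n) (y : EuclideanSpace ℝ (Fin n)) (r : ℝ) :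
    EuclideanSpace ℝ (Fin n) → ℝ :=
  r ^ (n / p - n : ℝ) • dilate y r (coordBump i)

theorem contDiff_concBump : ContDiff ℝ ∞ (concBump p i y r) :=
  (contDiff_dilate (contDiff_annulusBump i)).const_smul (r ^ (1 - n / p : ℝ))

theorem contDiff_concWeight : ContDiff ℝ ∞ (concWeight p i y r) :=
  (contDiff_dilate (contDiff_coordBump i)).const_smul (r ^ (n / p - n : ℝ))

theorem tsupport_concBump_subset (hr : 0 < r) : tsupport (concBump p i y r) ⊆ annulus y r :=
  (tsupport_smul_subset_right (fun _ => r ^ (1 - n / p : ℝ)) _).trans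
    (tsupport_dilate_subset hr (norm_of_annulusBump_ne_zero i))

theorem tsupport_concWeight_subset (hr : 0 < r) : tsupport (concWeight p i y r) ⊆ annulus y r :=
  (tsupport_smul_subset_right (fun _ => r ^ (n / p - n : ℝ)) _).trans
    (tsupport_dilate_subset hr (norm_of_coordBump_ne_zero i))

theorem hasCompactSupport_of_tsupport_subset_annulus {h : EuclideanSpace ℝ (Fin n) → ℝ}
    (hh : tsupport h ⊆ annulus y r) : HasCompactSupport h :=
  (isCompact_closedBall y (3 * r)).of_isClosed_subset (isClosed_tsupport h)
    (hh.trans annulus_subset_closedBall)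

theorem fderiv_concBump (hr : 0 < r) (x : EuclideanSpace ℝ (Fin n)) :
    fderiv ℝ (concBump p i y r) x =
      r ^ (-(n / p : ℝ)) • fderiv ℝ (annulusBump i) (r⁻¹ • (x - y)) := by
  rw [concBump, fderiv_const_smul ((contDiff_dilate (contDiff_annulusBump i)).differentiable
    (by simp) x), fderiv_dilate (contDiff_annulusBump i), smul_smul, Real.rpow_sub hr,
    Real.rpow_one, Real.rpow_neg hr.le]
  congr 1
  field_simp

/-- The powers r^{n/p-n} of the weight and r^{-n/p} of the gradient multiply to r^{-n}, which
cancels the Jacobian of the dilation. -/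
theorem concWeight_mul_fderiv_concBump (hr : 0 < r) :
    ∫ x, concWeight p i y r x * fderiv ℝ (concBump p i y r) x (EuclideanSpace.single i 1) =
      ∫ z, coordBump i z * fderiv ℝ (annulusBump i) z (EuclideanSpace.single i 1) := by
  have h1 : ∀ x, concWeight p i y r x *
      fderiv ℝ (concBump p i y r) x (EuclideanSpace.single i 1) =
      (r ^ n)⁻¹ * dilate y r (fun z => coordBump i z *
        fderiv ℝ (annulusBump i) z (EuclideanSpace.single i 1)) x := fun x => by
    rw [fderiv_concBump hr, concWeight]
    simp only [Pi.smul_apply, smul_eq_mul, dilate, smul_apply]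
    have : r ^ (n / p - n : ℝ) * r ^ (-(n / p : ℝ)) = (r ^ n)⁻¹ := by
      rw [← Real.rpow_add hr, ← Real.rpow_natCast, ← Real.rpow_neg hr.le]
      congr 1
      ring
    rw [← this]
    ring
  simp only [h1]
  rw [integral_const_mul, integral_dilate hr, inv_mul_cancel_left₀ (by positivity)]

/-- On the annulus |x - y| ≤ 3r, so r^{-n/p} ≤ 3^{n/p} |x - y|^{-n/p}. The bump itself carries an
additional factor r ≤ ρ, so one majorant serves for it and its derivative. -/
theorem exists_concBump_le (hp : 0 < p) (i : Fin n) (y : EuclideanSpace ℝ (Fin n)) {ρ : ℝ}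
    (hρ : 0 < ρ) :
    ∃ M > 0, ∀ r, 0 < r → r ≤ ρ → ∀ x, ‖concBump p i y r x‖ ≤ M * dist x y ^ (-(n / p : ℝ)) ∧
      ‖fderiv ℝ (concBump p i y r) x‖ ≤ M * dist x y ^ (-(n / p : ℝ)) := by
  obtain ⟨M1, hM1⟩ := (contDiff_annulusBump i).continuous.bounded_above_of_compact_support
    (hasCompactSupport_annulusBump i)
  obtain ⟨M2, hM2⟩ := ((contDiff_annulusBump i).continuous_fderiv (by simp)
    ).bounded_above_of_compact_support ((hasCompactSupport_annulusBump i).fderiv ℝ)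
  have h1 : 0 ≤ M1 := (norm_nonneg _).trans (hM1 0)
  have h2 : 0 ≤ M2 := (norm_nonneg _).trans (hM2 0)
  -- The first term controls the function, the second its derivative; the 1 makes B positive.
  set B := ρ * M1 + M2 + 1
  have hB : 0 < B := by positivity
  refine ⟨B * 3 ^ (n / p : ℝ), by positivity, fun r hr hrρ x => ?_⟩
  have hd : 0 ≤ dist x y := dist_nonneg
  by_cases hx : x ∈ annulus y r
  · have hd0 : 0 < dist x y := hr.trans_le hx.1
    have hrd : r ^ (-(n / p : ℝ)) ≤ 3 ^ (n / p : ℝ) * dist x y ^ (-(n / p : ℝ)) := by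
      rw [Real.rpow_neg hr.le, Real.rpow_neg hd, ← div_eq_mul_inv, inv_eq_one_div,
        div_le_div_iff₀ (by positivity) (by positivity), one_mul,
        ← Real.mul_rpow (by norm_num) hr.le]
      exact Real.rpow_le_rpow hd hx.2 (by positivity)
    have hr0 : 0 ≤ r ^ (-(n / p : ℝ)) := by positivity
    have hfin : ∀ a, a ≤ B → r ^ (-(n / p : ℝ)) * a ≤
        B * 3 ^ (n / p : ℝ) * dist x y ^ (-(n / p : ℝ)) := fun a ha => by
      calc _ ≤ r ^ (-(n / p : ℝ)) * B := by gcongr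
        _ ≤ (3 ^ (n / p : ℝ) * dist x y ^ (-(n / p : ℝ))) * B := by gcongr
        _ = _ := by ring
    constructor
    · have h3 : ‖concBump p i y r x‖ =
          r ^ (-(n / p : ℝ)) * (r * ‖annulusBump i (r⁻¹ • (x - y))‖) := by
        rw [concBump, Pi.smul_apply, norm_smul, dilate, Real.norm_of_nonneg (by positivity),
          sub_eq_add_neg, Real.rpow_add hr, Real.rpow_one]
        ring
      rw [h3]
      refine hfin _ ?_
      calc _ ≤ ρ * M1 := mul_le_mul hrρ (hM1 _) (norm_nonneg _) hρ.le
        _ ≤ B := by simp only [B]; linarith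
    · rw [fderiv_concBump hr, norm_smul, Real.norm_of_nonneg hr0]
      refine hfin _ ((hM2 _).trans ?_)
      have : 0 ≤ ρ * M1 := by positivity
      simp only [B]; linarith
  · have hx' : x ∉ tsupport (concBump p i y r) := fun h => hx (tsupport_concBump_subset hr h)
    rw [image_eq_zero_of_notMem_tsupport hx',
      image_eq_zero_of_notMem_tsupport fun h => hx' (tsupport_fderiv_subset ℝ h), norm_zero,
      norm_zero]
    constructor <;> positivity

theorem exists_concWeight_le (p : ℝ) (i : Fin n) (y : EuclideanSpace ℝ (Fin n)) :
    ∃ M ≥ 0, ∀ r, 0 < r → ∀ x, |concWeight p i y r x| ≤ M * r ^ (n / p - n : ℝ) := by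
  obtain ⟨M, hM⟩ := (contDiff_coordBump i).continuous.bounded_above_of_compact_support
    (hasCompactSupport_coordBump i)
  refine ⟨M, (norm_nonneg _).trans (hM 0), fun r hr x => ?_⟩
  rw [concWeight, Pi.smul_apply, smul_eq_mul, abs_mul, abs_of_pos (Real.rpow_pos_of_pos hr _),
    mul_comm]
  gcongr
  exact hM _

theorem concWeight_eq_zero (hr : 0 < r) {x : EuclideanSpace ℝ (Fin n)}
    (hx : x ∉ Metric.ball y (4 * r)) : concWeight p i y r x = 0 :=
  image_eq_zero_of_notMem_tsupport fun h =>
    hx (annulus_subset_ball hr (tsupport_concWeight_subset hr h))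

/-- The volume of a ball of radius `4r`. -/
def ballVolume (n : ℕ) (r : ℝ) : ℝ :=
  (4 * r) ^ n * (volume (Metric.ball (0 : EuclideanSpace ℝ (Fin n)) 1)).toReal

theorem ballVolume_pos (hr : 0 < r) : 0 < ballVolume n r :=
  mul_pos (by positivity) volume_unit_ball_toReal_pos

theorem volume_ball_eq_ballVolume (hn : 1 ≤ n) (y : EuclideanSpace ℝ (Fin n)) (hr : 0 < r) :
    volume (Metric.ball y (4 * r)) = ENNReal.ofReal (ballVolume n r) :=
  volume_ball_euclidean hn y (by positivity)

/-- The supremum of the weight scales like r^{n/p-n} and the volume factor in Hardy–Littlewood like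
r^{n-n/p}. Their cancellation makes the pairings bounded uniformly in r. -/
theorem rpow_mul_ballVolume_rpow (hr : 0 < r) :
    r ^ (n / p - n : ℝ) * ballVolume n r ^ (1 - 1 / p) = ballVolume n 1 ^ (1 - 1 / p) := by
  have h1 : ballVolume n r = r ^ (n : ℝ) * ballVolume n 1 := by
    rw [ballVolume, ballVolume, Real.rpow_natCast]
    ring
  have h2 : 0 < ballVolume n 1 := ballVolume_pos one_pos
  rw [h1, Real.mul_rpow (by positivity) h2.le, ← mul_assoc, ← Real.rpow_mul hr.le,
    ← Real.rpow_add hr]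
  rw [show (n / p - n : ℝ) + n * (1 - 1 / p) = 0 by ring, Real.rpow_zero, one_mul]

end ConcentratingBump

/-! ### The series of bumps concentrating at y -/

section Series

variable {n : ℕ} {p : ℝ} {i : Fin n} {y : EuclideanSpace ℝ (Fin n)} {ρ : ℝ}

/-- The radii `ρ 4^{-k}`. -/
def radius (ρ : ℝ) (k : ℕ) : ℝ := ρ / 4 ^ k

theorem radius_pos (hρ : 0 < ρ) (k : ℕ) : 0 < radius ρ k := by
  unfold radius
  positivity

theorem radius_antitone (hρ : 0 < ρ) : Antitone (radius ρ) := fun j k hjk => by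
  unfold radius
  gcongr
  norm_num

theorem radius_le (hρ : 0 < ρ) (k : ℕ) : radius ρ k ≤ ρ := by
  simpa [radius] using radius_antitone hρ (Nat.zero_le k)

theorem tendsto_radius (ρ : ℝ) : Tendsto (radius ρ) atTop (𝓝 0) := by
  have h := (tendsto_pow_atTop_nhds_zero_of_lt_one (r := (1 / 4 : ℝ)) (by norm_num)
    (by norm_num)).const_mul ρ
  rw [mul_zero] at h
  refine h.congr fun k => ?_
  rw [radius, div_pow, one_pow, mul_one_div]

theorem tendsto_radius_nhdsGT (hρ : 0 < ρ) : Tendsto (radius ρ) atTop (𝓝[>] 0) :=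
  tendsto_nhdsWithin_iff.2 ⟨tendsto_radius ρ, .of_forall fun k => radius_pos hρ k⟩

/-- The ratio 4 makes the annuli disjoint: the outer radius 3 r_{k+1} = ¾ r_k stays below the inner
radius r_k. -/
theorem eq_of_mem_annulus (hρ : 0 < ρ) {j k : ℕ} {x : EuclideanSpace ℝ (Fin n)}
    (hj : x ∈ annulus y (radius ρ j)) (hk : x ∈ annulus y (radius ρ k)) : j = k := by
  have key : ∀ {j k : ℕ}, x ∈ annulus y (radius ρ j) → x ∈ annulus y (radius ρ k) → ¬ j < k := by
    intro j k hj hk hjk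
    have h1 : radius ρ k ≤ radius ρ (j + 1) := radius_antitone hρ hjk
    have h2 : radius ρ (j + 1) = radius ρ j / 4 := by
      rw [radius, radius, pow_succ, div_div]
    have h3 := radius_pos hρ j
    linarith [hj.1, hk.2]
  exact le_antisymm (not_lt.1 (key hk hj)) (not_lt.1 (key hj hk))

/-- Disjointness of supports turns the bound for one bump into a bound for all partial sums,
independent of their length. -/
theorem norm_sum_le_of_subsingleton_support {V : Type*} [SeminormedAddCommGroup V] {a : ℕ → V}
    {B : ℝ} (hB : 0 ≤ B) (ha : ∀ k, ‖a k‖ ≤ B) (h : ∀ j k, a j ≠ 0 → a k ≠ 0 → j = k)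
    (s : Finset ℕ) : ‖∑ k ∈ s, a k‖ ≤ B := by
  by_cases h0 : ∃ k ∈ s, a k ≠ 0
  · obtain ⟨k, hk, hak⟩ := h0
    rw [Finset.sum_eq_single_of_mem k hk fun j _ hj => by_contra fun haj => hj (h j k haj hak)]
    exact ha k
  · push Not at h0
    rwa [Finset.sum_eq_zero h0, norm_zero]

/-- The partial sums of the series of bumps concentrating at `y`. -/
def bumpSum (p : ℝ) (i : Fin n) (y : EuclideanSpace ℝ (Fin n)) (ρ : ℝ) (N : ℕ)
    (x : EuclideanSpace ℝ (Fin n)) : ℝ :=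
  ∑ k ∈ Finset.range N, concBump p i y (radius ρ k) x

/-- The sum of the series of bumps concentrating at `y`. -/
def bumpSeries (p : ℝ) (i : Fin n) (y : EuclideanSpace ℝ (Fin n)) (ρ : ℝ)
    (x : EuclideanSpace ℝ (Fin n)) : ℝ :=
  ∑' k, concBump p i y (radius ρ k) x

theorem mem_annulus_of_concBump_ne_zero (hρ : 0 < ρ) {k : ℕ} {x : EuclideanSpace ℝ (Fin n)}
    (hx : concBump p i y (radius ρ k) x ≠ 0) : x ∈ annulus y (radius ρ k) :=
  tsupport_concBump_subset (radius_pos hρ k) (subset_tsupport _ hx)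

theorem mem_annulus_of_fderiv_concBump_ne_zero (hρ : 0 < ρ) {k : ℕ}
    {x : EuclideanSpace ℝ (Fin n)} (hx : fderiv ℝ (concBump p i y (radius ρ k)) x ≠ 0) :
    x ∈ annulus y (radius ρ k) :=
  tsupport_concBump_subset (radius_pos hρ k) (tsupport_fderiv_subset ℝ (subset_tsupport _ hx))

theorem contDiff_bumpSum (N : ℕ) : ContDiff ℝ ∞ (bumpSum p i y ρ N) :=
  ContDiff.sum fun _ _ => contDiff_concBump

theorem fderiv_bumpSum (N : ℕ) (x : EuclideanSpace ℝ (Fin n)) :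
    fderiv ℝ (bumpSum p i y ρ N) x =
      ∑ k ∈ Finset.range N, fderiv ℝ (concBump p i y (radius ρ k)) x :=
  fderiv_fun_sum fun _ _ => contDiff_concBump.differentiable (by simp) x

theorem exists_bumpSum_le (hp : 0 < p) (i : Fin n) (y : EuclideanSpace ℝ (Fin n)) (hρ : 0 < ρ) :
    ∃ M > 0, ∀ N x, ‖bumpSum p i y ρ N x‖ ≤ M * dist x y ^ (-(n / p : ℝ)) ∧
      ‖fderiv ℝ (bumpSum p i y ρ N) x‖ ≤ M * dist x y ^ (-(n / p : ℝ)) := by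
  obtain ⟨M, hM, h⟩ := exists_concBump_le hp i y hρ
  refine ⟨M, hM, fun N x => ⟨?_, ?_⟩⟩
  · exact norm_sum_le_of_subsingleton_support (by positivity)
      (fun k => (h _ (radius_pos hρ k) (radius_le hρ k) x).1) (fun j k hj hk =>
      eq_of_mem_annulus hρ (mem_annulus_of_concBump_ne_zero hρ hj)
        (mem_annulus_of_concBump_ne_zero hρ hk)) _
  · rw [fderiv_bumpSum]
    exact norm_sum_le_of_subsingleton_support (by positivity)
      (fun k => (h _ (radius_pos hρ k) (radius_le hρ k) x).2) (fun j k hj hk =>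
      eq_of_mem_annulus hρ (mem_annulus_of_fderiv_concBump_ne_zero hρ hj)
        (mem_annulus_of_fderiv_concBump_ne_zero hρ hk)) _

/-- The bumps of index at least N live within distance 3 r_N of y, so the series is locally finite
away from y. -/
theorem bumpSeries_eq_bumpSum (hρ : 0 < ρ) {N : ℕ} {x : EuclideanSpace ℝ (Fin n)}
    (hx : 3 * radius ρ N < dist x y) : bumpSeries p i y ρ x = bumpSum p i y ρ N x := by
  refine tsum_eq_sum fun k hk => by_contra fun hne => ?_
  have h1 := (mem_annulus_of_concBump_ne_zero hρ hne).2
  have h2 := radius_antitone hρ (not_lt.1 fun h => hk (Finset.mem_range.2 h))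
  linarith

theorem bumpSeries_eventuallyEq (hρ : 0 < ρ) {N : ℕ} {x : EuclideanSpace ℝ (Fin n)}
    (hx : 3 * radius ρ N < dist x y) : bumpSeries p i y ρ =ᶠ[𝓝 x] bumpSum p i y ρ N := by
  have : {z | 3 * radius ρ N < dist z y} ∈ 𝓝 x :=
    (isOpen_lt (by fun_prop) (by fun_prop)).mem_nhds hx
  filter_upwards [this] with z hz
  exact bumpSeries_eq_bumpSum hρ hz

theorem eventually_radius_lt_dist (ρ : ℝ) {x : EuclideanSpace ℝ (Fin n)} (hx : x ≠ y) :
    ∀ᶠ N in atTop, 3 * radius ρ N < dist x y := by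
  have h := (tendsto_radius ρ).const_mul 3
  rw [mul_zero] at h
  exact h.eventually (gt_mem_nhds (dist_pos.2 hx))

theorem bumpSeries_eq_concBump (hρ : 0 < ρ) {k : ℕ} {x : EuclideanSpace ℝ (Fin n)}
    (hx : x ∈ annulus y (radius ρ k)) :
    bumpSeries p i y ρ x = concBump p i y (radius ρ k) x :=
  tsum_eq_single k fun _ hj => by_contra fun hne =>
    hj (eq_of_mem_annulus hρ (mem_annulus_of_concBump_ne_zero hρ hne) hx)

theorem contDiffOn_bumpSeries (hρ : 0 < ρ)
    (Ω : TopologicalSpace.Opens (EuclideanSpace ℝ (Fin n))) :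
    ContDiffOn ℝ ∞ (bumpSeries p i y ρ) (puncture Ω y) := fun x hx => by
  obtain ⟨N, hN⟩ := (eventually_radius_lt_dist ρ hx.2).exists
  exact ((contDiff_bumpSum N).contDiffAt.congr_of_eventuallyEq
    (bumpSeries_eventuallyEq hρ hN)).contDiffWithinAt

theorem exists_bumpSeries_le (hp : 0 < p) (i : Fin n) (y : EuclideanSpace ℝ (Fin n))
    (hρ : 0 < ρ) :
    ∃ M > 0, ∀ x, x ≠ y → ‖bumpSeries p i y ρ x‖ ≤ M * dist x y ^ (-(n / p : ℝ)) ∧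
      ‖fderiv ℝ (bumpSeries p i y ρ) x‖ ≤ M * dist x y ^ (-(n / p : ℝ)) := by
  obtain ⟨M, hM, h⟩ := exists_bumpSum_le hp i y hρ
  refine ⟨M, hM, fun x hx => ?_⟩
  obtain ⟨N, hN⟩ := (eventually_radius_lt_dist ρ hx).exists
  rw [bumpSeries_eq_bumpSum hρ hN, (bumpSeries_eventuallyEq hρ hN).fderiv_eq]
  exact h N x

theorem enorm_le_enorm_of_norm_le_real {V : Type*} [NormedAddCommGroup V] {v : V} {a : ℝ}
    (h : ‖v‖ ≤ a) : ‖v‖ₑ ≤ ‖a‖ₑ := by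
  rw [← ofReal_norm, Real.enorm_of_nonneg ((norm_nonneg v).trans h)]
  exact ENNReal.ofReal_le_ofReal h

theorem tsupport_bumpSum_subset (hρ : 0 < ρ) (N : ℕ) :
    tsupport (bumpSum p i y ρ N) ⊆ Metric.closedBall y (3 * ρ) := by
  refine closure_minimal (fun x hx => ?_) Metric.isClosed_closedBall
  obtain ⟨k, -, hk⟩ := Finset.exists_ne_zero_of_sum_ne_zero hx
  exact (mem_annulus_of_concBump_ne_zero hρ hk).2.trans
    (mul_le_mul_of_nonneg_left (radius_le hρ k) (by norm_num))

variable {Ω : TopologicalSpace.Opens (EuclideanSpace ℝ (Fin n))}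

theorem exists_lorentzENorm_bumpSum_le (hn : 1 ≤ n) (hp : 1 < p) (i : Fin n)
    (y : EuclideanSpace ℝ (Fin n)) (hρ : 0 < ρ)
    (Ω : TopologicalSpace.Opens (EuclideanSpace ℝ (Fin n))) :
    ∃ K : ℝ≥0∞, K < ⊤ ∧ ∀ N, lorentzENorm p ⊤ (volume.restrict Ω) (bumpSum p i y ρ N) ≤ K ∧
      lorentzENorm p ⊤ (volume.restrict Ω) (gradient (bumpSum p i y ρ N)) ≤ K := by
  obtain ⟨M, hM, h⟩ := exists_bumpSum_le (zero_lt_one.trans hp) i y hρ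
  refine ⟨_, lorentzENorm_rpow_dist_lt_top hn hp y Ω hM, fun N =>
    ⟨lorentzENorm_mono_enorm (.of_forall fun x => ?_),
      lorentzENorm_mono_enorm (.of_forall fun x => ?_)⟩⟩
  · exact enorm_le_enorm_of_norm_le_real (h N x).1
  · exact enorm_le_enorm_of_norm_le_real ((norm_gradient _ x).trans_le (h N x).2)

/-- Off y the series is already smooth with finite norms, so it approximates itself. -/
theorem isSmoothLimit_bumpSeries (hn : 1 ≤ n) (hp : 1 < p) (i : Fin n)
    (y : EuclideanSpace ℝ (Fin n)) (hρ : 0 < ρ)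
    (Ω : TopologicalSpace.Opens (EuclideanSpace ℝ (Fin n))) :
    IsSmoothLimit p ⊤ (puncture Ω y) (bumpSeries p i y ρ) (gradient (bumpSeries p i y ρ)) := by
  obtain ⟨M, hM, h⟩ := exists_bumpSeries_le (zero_lt_one.trans hp) i y hρ
  have hae : ∀ᵐ x ∂(volume.restrict (puncture Ω y : Set (EuclideanSpace ℝ (Fin n)))), x ≠ y := by
    filter_upwards [ae_restrict_mem (puncture Ω y).isOpen.measurableSet] with x hx
    exact hx.2
  have hlt := lorentzENorm_rpow_dist_lt_top hn hp y (puncture Ω y) hM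
  refine isSmoothLimit_gradient (contDiffOn_bumpSeries hρ Ω) (lt_of_le_of_lt
    (lorentzENorm_mono_enorm ?_) hlt) (lt_of_le_of_lt (lorentzENorm_mono_enorm ?_) hlt)
  · filter_upwards [hae] with x hx
    exact enorm_le_enorm_of_norm_le_real (h x hx).1
  · filter_upwards [hae] with x hx
    exact enorm_le_enorm_of_norm_le_real ((norm_gradient _ x).trans_le (h x hx).2)

/-- The point y carries no part of the weak derivative: the partial sums are smooth across y, and |x
- y|^{-n/p} is locally integrable, so dominated convergence applies to both sides of their
integration-by-parts identities. -/
theorem isWeakPartial_bumpSeries (hn : 1 ≤ n) (hp : 1 < p) (i j : Fin n)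
    (y : EuclideanSpace ℝ (Fin n)) (hρ : 0 < ρ)
    (Ω : TopologicalSpace.Opens (EuclideanSpace ℝ (Fin n))) :
    IsWeakPartial Ω j (bumpSeries p i y ρ) fun x => gradient (bumpSeries p i y ρ) x j := by
  have : Nonempty (Fin n) := ⟨i⟩
  have hs := isSmoothLimit_bumpSeries hn hp i y hρ Ω
  obtain ⟨hm1, hm2, hf1, hf2, -⟩ := hs
  rw [restrict_puncture hn] at hm1 hm2 hf1 hf2
  obtain ⟨M, hM, h⟩ := exists_bumpSum_le (zero_lt_one.trans hp) i y hρ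
  set G : EuclideanSpace ℝ (Fin n) → ℝ := fun x => M * dist x y ^ (-(n / p : ℝ)) with hG
  have hGm : Measurable G := by
    have : Measurable fun x : EuclideanSpace ℝ (Fin n) => dist x y := by fun_prop
    exact (this.pow_const _).const_mul M
  have hGint : LocallyIntegrableOn G Ω := locallyIntegrableOn_of_lorentzENorm_top hp
    hGm.aestronglyMeasurable (lorentzENorm_rpow_dist_lt_top hn hp y Ω hM)
  have hae : ∀ᵐ x ∂(volume.restrict (Ω : Set (EuclideanSpace ℝ (Fin n)))), x ≠ y :=
    ae_restrict_of_ae (by simp [ae_iff])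
  -- Stated generally so as to apply once to the derivatives and once to the functions; off y the
  -- sequences are eventually constant.
  have hlim : ∀ (θ : EuclideanSpace ℝ (Fin n) → ℝ) (a : ℕ → EuclideanSpace ℝ (Fin n) → ℝ)
      (b : EuclideanSpace ℝ (Fin n) → ℝ), Continuous θ → HasCompactSupport θ → tsupport θ ⊆ Ω →
      (∀ N, Continuous (a N)) → (∀ N x, ‖a N x‖ ≤ G x) →
      (∀ x, x ≠ y → ∀ᶠ N in atTop, a N x = b x) →
      Tendsto (fun N => ∫ x in Ω, θ x * a N x) atTop (𝓝 (∫ x in Ω, θ x * b x)) := by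
    intro θ a b hθ hc hsub hac haG hab
    refine tendsto_integral_of_dominated_convergence (fun x => |θ x| * G x)
      (fun N => (hθ.mul (hac N)).aestronglyMeasurable) ?_ (fun N => .of_forall fun x => ?_) ?_
    · exact integrableOn_mul_of_locallyIntegrableOn hGint hθ.abs hc.norm
        ((closure_mono fun x hx => by simpa using hx).trans hsub)
    · rw [norm_mul]
      exact mul_le_mul_of_nonneg_left (haG N x) (norm_nonneg _)
    · filter_upwards [hae] with x hx
      refine tendsto_const_nhds.congr' ?_
      filter_upwards [hab x hx] with N hN
      rw [hN]
  refine ⟨locallyIntegrableOn_of_lorentzENorm_top hp hm1 hf1,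
    locallyIntegrableOn_of_lorentzENorm_top hp (aestronglyMeasurable_apply hm2 j)
    ((lorentzENorm_apply_le _ j).trans_lt hf2), fun ψ hψ hc hsub => ?_⟩
  have l1 := hlim ψ (fun N x => fderiv ℝ (bumpSum p i y ρ N) x (EuclideanSpace.single j 1))
    (fun x => gradient (bumpSeries p i y ρ) x j) hψ.continuous hc hsub
    (fun N => ((contDiff_bumpSum N).continuous_fderiv (by simp)).clm_apply continuous_const)
    (fun N x => (ContinuousLinearMap.le_opNorm _ _).trans (by simpa using (h N x).2))
    (fun x hx => (eventually_radius_lt_dist ρ hx).mono fun N hN => by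
      rw [gradient_apply, (bumpSeries_eventuallyEq hρ hN).fderiv_eq])
  have l2 := hlim (fun x => fderiv ℝ ψ x (EuclideanSpace.single j 1)) (bumpSum p i y ρ)
    (bumpSeries p i y ρ) ((hψ.continuous_fderiv (by simp)).clm_apply continuous_const)
    (hc.fderiv_apply ℝ _) (tsupport_fderiv_subset_of_tsupport hsub)
    (fun N => (contDiff_bumpSum N).continuous) (fun N x => (h N x).1)
    (fun x hx => (eventually_radius_lt_dist ρ hx).mono fun N hN =>
      (bumpSeries_eq_bumpSum hρ hN).symm)
  exact tendsto_nhds_unique l1 (l2.neg.congr fun N =>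
    ((isWeakPartial_of_smoothOn (contDiff_bumpSum N).contDiffOn).2.2 ψ hψ hc hsub).symm)

theorem bumpSeries_mem_funH (hn : 1 ≤ n) [hp : Fact (1 < p)] (i : Fin n)
    (y : EuclideanSpace ℝ (Fin n)) (hρ : 0 < ρ)
    (Ω : TopologicalSpace.Opens (EuclideanSpace ℝ (Fin n))) :
    bumpSeries p i y ρ ∈ funH p ⊤ (puncture Ω y) :=
  (isSmoothLimit_bumpSeries hn hp.out i y hρ Ω).mem_funH

theorem bumpSeries_mem_funW (hn : 1 ≤ n) [hp : Fact (1 < p)] (i : Fin n)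
    (y : EuclideanSpace ℝ (Fin n)) (hρ : 0 < ρ)
    (Ω : TopologicalSpace.Opens (EuclideanSpace ℝ (Fin n))) :
    bumpSeries p i y ρ ∈ funW p ⊤ Ω := by
  obtain ⟨hm1, hm2, hf1, hf2, -⟩ := isSmoothLimit_bumpSeries hn hp.out i y hρ Ω
  rw [restrict_puncture hn] at hm1 hm2 hf1 hf2
  exact mem_funW_of_isWeakPartial hm1 hm2 hf1 hf2 fun j =>
    isWeakPartial_bumpSeries hn hp.out i j y hρ Ω

end Series

/-! ### An obstruction to reflexivity -/

section Reflexivity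

/-- A bounded sequence with a uniformly bounded sequence of functionals that sees it as the
summing basis of `c₀` obstructs reflexivity. -/
theorem not_isReflexiveSpace_of_summing {X : Type*} [NormedAddCommGroup X] [NormedSpace ℝ X]
    (s : ℕ → X) (f : ℕ → StrongDual ℝ X) {B C c : ℝ} (hB : ∀ N, ‖s N‖ ≤ B) (hC : ∀ k, ‖f k‖ ≤ C)
    (hc : c ≠ 0) (h1 : ∀ k N, k < N → f k (s N) = c) (h0 : ∀ k N, N ≤ k → f k (s N) = 0) :
    ¬ IsReflexiveSpace X := by
  intro hX
  have hB0 : 0 ≤ B := (norm_nonneg _).trans (hB 0)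
  have hC0 : 0 ≤ C := (norm_nonneg _).trans (hC 0)
  -- A free ultrafilter gives every bounded sequence `φ (s N)` a limit, linear in φ and bounded by
  -- `B * ‖φ‖`, hence an element of the bidual. Reflexivity represents it by a vector x.
  set U : Ultrafilter ℕ := hyperfilter ℕ with hU
  have hlim : ∀ φ : StrongDual ℝ X, ∃ a : ℝ, Tendsto (fun N => φ (s N)) U (𝓝 a) ∧
      ‖a‖ ≤ B * ‖φ‖ := fun φ => by
    have hmem : ∀ N, φ (s N) ∈ Metric.closedBall (0 : ℝ) (B * ‖φ‖) := fun N => by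
      rw [mem_closedBall_zero_iff, mul_comm]
      exact φ.le_of_opNorm_le_of_le le_rfl (hB N)
    obtain ⟨a, ha, hle⟩ := (isCompact_closedBall (0 : ℝ) (B * ‖φ‖)).ultrafilter_le_nhds
      (U.map fun N => φ (s N)) (le_principal_iff.2 (Filter.mem_map.2 (Filter.univ_mem' hmem)))
    exact ⟨a, hle, mem_closedBall_zero_iff.1 ha⟩
  choose L hL hLB using hlim
  set Λ : StrongDual ℝ (StrongDual ℝ X) := LinearMap.mkContinuous
    { toFun := L
      map_add' := fun φ ψ => tendsto_nhds_unique (hL (φ + ψ)) ((hL φ).add (hL ψ))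
      map_smul' := fun a φ => tendsto_nhds_unique (hL (a • φ)) ((hL φ).const_mul a) } B hLB with hΛ
  obtain ⟨x, hx⟩ := hX Λ
  have hxL : ∀ φ : StrongDual ℝ X, Tendsto (fun N => φ (s N)) U (𝓝 (φ x)) := fun φ => by
    have : φ x = L φ := congrArg (fun Ψ : StrongDual ℝ (StrongDual ℝ X) => Ψ φ) hx
    rw [this]
    exact hL φ
  have hat : (U : Filter ℕ) ≤ atTop := Nat.hyperfilter_le_atTop
  have hfx : ∀ k, f k x = c := fun k => by
    refine tendsto_nhds_unique (hxL (f k)) (tendsto_const_nhds.congr' ?_)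
    filter_upwards [hat (eventually_gt_atTop k)] with N hN
    exact (h1 k N hN).symm
  set Y := Submodule.span ℝ (range s) with hY
  -- A functional separating x from the closed span would also separate x from its weak limit along
  -- U.
  have hxY : x ∈ closure (Y : Set X) := by
    by_contra hcon
    obtain ⟨φ, u, hu, hux⟩ := geometric_hahn_banach_closed_point Y.convex.closure
      isClosed_closure hcon
    refine absurd hux (not_lt.2 (le_of_tendsto (hxL φ) (.of_forall fun N => ?_)))
    exact (hu _ (subset_closure (Submodule.subset_span (mem_range_self N)))).le
  have hev : ∀ z ∈ Y, ∀ᶠ k in atTop, f k z = 0 := fun z hz => by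
    induction hz using Submodule.span_induction with
    | mem z hz =>
      obtain ⟨N, rfl⟩ := hz
      filter_upwards [eventually_ge_atTop N] with k hk
      exact h0 k N hk
    | zero => simp
    | add a b _ _ ha hb =>
      filter_upwards [ha, hb] with k h1 h2
      rw [map_add, h1, h2, add_zero]
    | smul r a _ ha =>
      filter_upwards [ha] with k h1
      rw [map_smul, h1, smul_zero]
  -- For k large f_k kills z, so |c| = |f_k(x - z)| ≤ C ‖x - z‖ < |c|. Using `C + 1` avoids a
  -- division by zero.
  obtain ⟨z, hz, hzx⟩ := Metric.mem_closure_iff.1 hxY (|c| / (C + 1)) (by positivity)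
  obtain ⟨k, hk⟩ := (hev z hz).exists
  have h2 : |c| ≤ C * ‖x - z‖ := by
    have := (f k).le_of_opNorm_le (hC k) (x - z)
    rwa [map_sub, hk, sub_zero, hfx, Real.norm_eq_abs] at this
  rw [dist_eq_norm, lt_div_iff₀ (by positivity)] at hzx
  nlinarith [norm_nonneg (x - z)]

end Reflexivity

/-! ### Testing gradients against weights concentrating at y -/

section Concentration

variable {n : ℕ} {p : ℝ} {i : Fin n} {y : EuclideanSpace ℝ (Fin n)} {ρ r : ℝ}
  {Ω : TopologicalSpace.Opens (EuclideanSpace ℝ (Fin n))}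

theorem restrict_ball_le_ballVolume (hn : 1 ≤ n) (y : EuclideanSpace ℝ (Fin n)) (hr : 0 < r)
    (S : Set (EuclideanSpace ℝ (Fin n))) :
    volume.restrict S (Metric.ball y (4 * r)) ≤ ENNReal.ofReal (ballVolume n r) :=
  (Measure.restrict_apply_le _ _).trans_eq (volume_ball_eq_ballVolume hn y hr)

/-- The constant does not depend on r. The right side yields both a uniform bound by the weak norm
and, for q < ∞, convergence to 0. -/
theorem exists_enorm_setIntegral_concWeight_mul_le (hn : 1 ≤ n) (p : ℝ) (i : Fin n)
    (y : EuclideanSpace ℝ (Fin n)) (S : Set (EuclideanSpace ℝ (Fin n))) :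
    ∃ C : ℝ≥0∞, C < ⊤ ∧ ∀ r, 0 < r → ∀ f : EuclideanSpace ℝ (Fin n) → ℝ,
      AEStronglyMeasurable f (volume.restrict S) →
      ‖∫ x in S, concWeight p i y r x * f x‖ₑ ≤ C * (ENNReal.ofReal (ballVolume n r) ^ (1 / p) *
        maximalRearrangement (volume.restrict S) f (ballVolume n r)) := by
  obtain ⟨M, hM, h⟩ := exists_concWeight_le p i y
  refine ⟨ENNReal.ofReal (M * ballVolume n 1 ^ (1 - 1 / p)), ENNReal.ofReal_lt_top,
    fun r hr f hf => ?_⟩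
  have hV := ballVolume_pos (n := n) hr
  refine (enorm_integral_le_lintegral_enorm _).trans
    ((lintegral_enorm_mul_le_lintegral_rearrangement hf (h r hr)
      (fun x hx => concWeight_eq_zero hr hx) (restrict_ball_le_ballVolume hn y hr S)).trans_eq ?_)
  rw [lintegral_rearrangement_eq_rpow_mul (p := p) f hV, ← mul_assoc,
    ENNReal.ofReal_rpow_of_pos hV, ← ENNReal.ofReal_mul (by positivity), mul_assoc M,
    rpow_mul_ballVolume_rpow hr]

theorem tendsto_ballVolume (hn : 1 ≤ n) : Tendsto (ballVolume n) (𝓝[>] 0) (𝓝[>] 0) := by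
  refine tendsto_nhdsWithin_iff.2 ⟨?_, ?_⟩
  · have h : Tendsto (ballVolume n) (𝓝 0) (𝓝 (ballVolume n 0)) := by
      refine Continuous.tendsto ?_ _
      unfold ballVolume
      fun_prop
    have h0 : ballVolume n 0 = 0 := by
      rw [ballVolume, mul_zero, zero_pow (by omega), zero_mul]
    rw [h0] at h
    exact h.mono_left nhdsWithin_le_nhds
  · filter_upwards [self_mem_nhdsWithin] with r hr
    exact ballVolume_pos hr

theorem IsSmoothLimit.tendsto_concWeight_of_ne_top (hn : 1 ≤ n) (hp : 0 < p) {q : ℝ≥0∞}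
    (hq : 1 ≤ q) (hqt : q ≠ ⊤) {u : EuclideanSpace ℝ (Fin n) → ℝ}
    {g : EuclideanSpace ℝ (Fin n) → EuclideanSpace ℝ (Fin n)} (h : IsSmoothLimit p q Ω u g)
    (i : Fin n) (y : EuclideanSpace ℝ (Fin n)) :
    Tendsto (fun r => ‖∫ x in Ω, concWeight p i y r x * g x i‖ₑ) (𝓝[>] 0) (𝓝 0) := by
  obtain ⟨C, hC, hle⟩ := exists_enorm_setIntegral_concWeight_mul_le hn p i y Ω
  have h1 := (tendsto_rpow_mul_maximalRearrangement hp hq hqt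
    ((lorentzENorm_apply_le g i).trans_lt h.snd_lt_top).ne).comp (tendsto_ballVolume hn)
  have h2 := ENNReal.Tendsto.const_mul h1 (Or.inr hC.ne)
  rw [mul_zero] at h2
  refine tendsto_of_tendsto_of_tendsto_of_le_of_le' tendsto_const_nhds h2
    (.of_forall fun _ => zero_le) ?_
  filter_upwards [self_mem_nhdsWithin] with r hr
  exact hle r hr _ (aestronglyMeasurable_apply h.aesm_snd i)

/-- The L¹ norm of the weight is of order r^{n/p-n} r^n = r^{n/p}, which tends to 0. -/
theorem tendsto_concWeight_of_bounded (hn : 1 ≤ n) (hp : 0 < p) {f : EuclideanSpace ℝ (Fin n) → ℝ}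
    {ε K : ℝ} (hε : 0 < ε) (hf : ∀ x ∈ Metric.ball y ε, |f x| ≤ K) (i : Fin n)
    (S : Set (EuclideanSpace ℝ (Fin n))) :
    Tendsto (fun r => ‖∫ x in S, concWeight p i y r x * f x‖ₑ) (𝓝[>] 0) (𝓝 0) := by
  obtain ⟨M, hM, h⟩ := exists_concWeight_le p i y
  have hn0 : (0 : ℝ) < n := by exact_mod_cast hn
  have hK : 0 ≤ K := (abs_nonneg _).trans (hf y (Metric.mem_ball_self hε))
  have hlim : Tendsto (fun r : ℝ => ENNReal.ofReal (M * K * ballVolume n 1 * r ^ (n / p : ℝ)))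
      (𝓝[>] 0) (𝓝 0) := by
    have h1 : Tendsto (fun r : ℝ => r ^ (n / p : ℝ)) (𝓝 0) (𝓝 (0 ^ (n / p : ℝ))) :=
      (Real.continuousAt_rpow_const 0 _ (Or.inr (by positivity))).tendsto
    rw [Real.zero_rpow (by positivity)] at h1
    have h2 := ENNReal.tendsto_ofReal (h1.const_mul (M * K * ballVolume n 1))
    rw [mul_zero, ENNReal.ofReal_zero] at h2
    exact h2.mono_left nhdsWithin_le_nhds
  refine tendsto_of_tendsto_of_tendsto_of_le_of_le' tendsto_const_nhds hlim
    (.of_forall fun _ => zero_le) ?_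
  filter_upwards [self_mem_nhdsWithin,
    nhdsWithin_le_nhds (Iio_mem_nhds (show (0 : ℝ) < ε / 4 by positivity))] with r hr hrε
  have hr : 0 < r := hr
  have hrε : 4 * r ≤ ε := by
    have : r < ε / 4 := hrε
    linarith
  have hV := ballVolume_pos (n := n) hr
  calc ‖∫ x in S, concWeight p i y r x * f x‖ₑ
      ≤ ∫⁻ x in S, ‖concWeight p i y r x * f x‖ₑ := enorm_integral_le_lintegral_enorm _
    _ = ∫⁻ x in Metric.ball y (4 * r), ‖concWeight p i y r x * f x‖ₑ ∂volume.restrict S := by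
        refine (setLIntegral_eq_of_support_subset fun x hx => ?_).symm
        by_contra hxA
        simp [concWeight_eq_zero hr hxA] at hx
    _ ≤ ∫⁻ x in Metric.ball y (4 * r), ENNReal.ofReal (M * r ^ (n / p - n : ℝ) * K)
          ∂volume.restrict S := by
        refine setLIntegral_mono' Metric.isOpen_ball.measurableSet fun x hx => ?_
        rw [Real.enorm_eq_ofReal_abs, abs_mul]
        exact ENNReal.ofReal_le_ofReal (mul_le_mul (h r hr x)
          (hf x (Metric.ball_subset_ball hrε hx)) (abs_nonneg _) (by positivity))
    _ ≤ ENNReal.ofReal (M * r ^ (n / p - n : ℝ) * K) * ENNReal.ofReal (ballVolume n r) := by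
        rw [setLIntegral_const]
        gcongr
        exact restrict_ball_le_ballVolume hn y hr S
    _ = ENNReal.ofReal (M * K * ballVolume n 1 * r ^ (n / p : ℝ)) := by
        rw [← ENNReal.ofReal_mul (by positivity)]
        congr 1
        have h1 : ballVolume n r = r ^ (n : ℝ) * ballVolume n 1 := by
          rw [ballVolume, ballVolume, Real.rpow_natCast]
          ring
        have h2 : r ^ (n / p : ℝ) = r ^ (n / p - n : ℝ) * r ^ (n : ℝ) := by
          rw [← Real.rpow_add hr, sub_add_cancel]
        rw [h1, h2]
        ring

/-- Density argument: the gradient of a smooth approximant is bounded near y because y ∈ Ω, and the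
remainder is small uniformly in r. Across a puncture at y the boundedness fails, which is the
content of (i). -/
theorem IsSmoothLimit.tendsto_concWeight (hn : 1 ≤ n) (hp : 1 < p)
    {u : EuclideanSpace ℝ (Fin n) → ℝ} {g : EuclideanSpace ℝ (Fin n) → EuclideanSpace ℝ (Fin n)}
    (h : IsSmoothLimit p ⊤ Ω u g) (i : Fin n) (hy : y ∈ Ω) :
    Tendsto (fun r => ‖∫ x in Ω, concWeight p i y r x * g x i‖ₑ) (𝓝[>] 0) (𝓝 0) := by
  obtain ⟨C, hC, hle⟩ := exists_enorm_setIntegral_concWeight_mul_le hn p i y Ω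
  have hy' : (Ω : Set (EuclideanSpace ℝ (Fin n))) ∈ 𝓝 y := Ω.isOpen.mem_nhds hy
  obtain ⟨ε, hε, hεΩ⟩ := Metric.mem_nhds_iff.1 hy'
  rw [ENNReal.tendsto_nhds_zero]
  intro δ hδ
  have hδ2 : 0 < δ / 2 := ENNReal.half_pos hδ.ne'
  -- The approximant is fixed before r → 0, which is legitimate because C is independent of r.
  obtain ⟨φ, hφ, -, h2⟩ := h.approx (δ / 2 / C) (ENNReal.div_pos hδ2.ne' hC.ne)
  have hφc : ContinuousAt (fun x => gradient φ x i) y :=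
    ((EuclideanSpace.proj (𝕜 := ℝ) i).continuous.comp_continuousOn
      (continuousOn_gradient hφ)).continuousAt hy'
  obtain ⟨ε', hε', hb⟩ := Metric.continuousAt_iff.1 hφc 1 one_pos
  have hbd := tendsto_concWeight_of_bounded (p := p) (K := |gradient φ y i| + 1)
    (f := fun x => gradient φ x i) hn
    (zero_lt_one.trans hp) hε' (fun x hx => by
      have h3 := hb hx
      rw [Real.dist_eq] at h3
      have h4 := abs_sub_abs_le_abs_sub (gradient φ x i) (gradient φ y i)
      linarith) i Ω
  filter_upwards [self_mem_nhdsWithin, ENNReal.tendsto_nhds_zero.1 hbd (δ / 2) hδ2,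
    nhdsWithin_le_nhds (Iio_mem_nhds (show (0 : ℝ) < ε / 4 by positivity))] with r hr hr2 hrε
  have hr : 0 < r := hr
  -- For 4r < ε the weight is a test function on Ω, so the pairings converge absolutely and the
  -- integral may be split.
  have hs : tsupport (concWeight p i y r) ⊆ Ω := by
    refine ((tsupport_concWeight_subset hr).trans (annulus_subset_ball hr)).trans
      ((Metric.ball_subset_ball ?_).trans hεΩ)
    have : r < ε / 4 := hrε
    linarith
  have hc := hasCompactSupport_of_tsupport_subset_annulus (tsupport_concWeight_subset
    (p := p) (i := i) (y := y) hr)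
  have hcont := (contDiff_concWeight (p := p) (i := i) (y := y) (r := r)).continuous
  have hi1 := integrableOn_mul_of_locallyIntegrableOn (h.isWeakPartial hp i).2.1 hcont hc hs
  have hi2 := integrableOn_mul_of_locallyIntegrableOn
    (isWeakPartial_of_smoothOn (i := i) hφ).2.1 hcont hc hs
  have e1 : ∫ x in Ω, concWeight p i y r x * g x i =
      (∫ x in Ω, concWeight p i y r x * (g - gradient φ) x i) +
      ∫ x in Ω, concWeight p i y r x * gradient φ x i := by
    simp only [← gradient_apply] at hi2
    rw [← sub_eq_iff_eq_add, ← integral_sub hi1 hi2]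
    congr 1 with x
    rw [Pi.sub_apply, PiLp.sub_apply, mul_sub]
  rw [e1]
  refine (enorm_add_le _ _).trans ?_
  calc _ ≤ C * (δ / 2 / C) + δ / 2 := by
        refine add_le_add ((hle r hr _ (aestronglyMeasurable_apply (h.aesm_snd.sub
          (aestronglyMeasurable_gradient_of_smoothOn hφ)) i)).trans ?_) hr2
        gcongr
        exact (ofReal_rpow_mul_maximalRearrangement_le_lorentzENorm_top _
          (ballVolume_pos hr)).trans ((lorentzENorm_apply_le _ i).trans h2.le)
    _ ≤ δ / 2 + δ / 2 := by
        gcongr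
        exact ENNReal.mul_div_le
    _ = δ := ENNReal.add_halves δ

theorem setIntegral_concWeight_mul_fderiv_concBump (hr : 0 < r) (hs : annulus y r ⊆ Ω) :
    ∫ x in Ω, concWeight p i y r x * fderiv ℝ (concBump p i y r) x (EuclideanSpace.single i 1) =
      ∫ z, coordBump i z * fderiv ℝ (annulusBump i) z (EuclideanSpace.single i 1) := by
  rw [setIntegral_eq_integral_of_forall_compl_eq_zero, concWeight_mul_fderiv_concBump hr]
  intro x hx
  rw [image_eq_zero_of_notMem_tsupport fun h => hx (hs (tsupport_concWeight_subset hr h)),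
    zero_mul]

/-- Holds for any weak derivative v, with no need to identify it: move the derivative onto the
weight, replace the series by its single bump on the annulus, and move the derivative back. -/
theorem IsWeakPartial.setIntegral_concWeight (hρ : 0 < ρ) {k : ℕ}
    (hs : annulus y (radius ρ k) ⊆ Ω) {v : EuclideanSpace ℝ (Fin n) → ℝ}
    (h : IsWeakPartial Ω i (bumpSeries p i y ρ) v) :
    ∫ x in Ω, concWeight p i y (radius ρ k) x * v x =
      ∫ z, coordBump i z * fderiv ℝ (annulusBump i) z (EuclideanSpace.single i 1) := by
  have hr := radius_pos hρ k
  have hsub := tsupport_concWeight_subset (p := p) (i := i) (y := y) hr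
  have hc := hasCompactSupport_of_tsupport_subset_annulus hsub
  rw [h.2.2 _ contDiff_concWeight hc (hsub.trans hs),
    ← setIntegral_concWeight_mul_fderiv_concBump (p := p) hr hs,
    (isWeakPartial_of_smoothOn contDiff_concBump.contDiffOn).2.2 _ contDiff_concWeight hc
      (hsub.trans hs)]
  congr 2 with x
  by_cases hx : x ∈ annulus y (radius ρ k)
  · rw [bumpSeries_eq_concBump hρ hx]
  · rw [image_eq_zero_of_notMem_tsupport (f := fun x => fderiv ℝ (concWeight p i y (radius ρ k)) x
      (EuclideanSpace.single i 1)) fun h => hx (hsub (tsupport_fderiv_apply_subset ℝ _ h)),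
      zero_mul, zero_mul]

theorem setIntegral_concWeight_bumpSum (hρ : 0 < ρ) {k N : ℕ}
    (hs : annulus y (radius ρ k) ⊆ Ω) :
    ∫ x in Ω, concWeight p i y (radius ρ k) x * gradient (bumpSum p i y ρ N) x i =
      if k < N then ∫ z, coordBump i z * fderiv ℝ (annulusBump i) z (EuclideanSpace.single i 1)
      else 0 := by
  have hr := radius_pos hρ k
  have h1 : ∀ x, concWeight p i y (radius ρ k) x * gradient (bumpSum p i y ρ N) x i =
      if k < N then concWeight p i y (radius ρ k) x *
        fderiv ℝ (concBump p i y (radius ρ k)) x (EuclideanSpace.single i 1) else 0 := fun x => by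
    by_cases hx : x ∈ annulus y (radius ρ k)
    · have h2 : ∀ j, j ≠ k → fderiv ℝ (concBump p i y (radius ρ j)) x = 0 := fun j hj =>
        by_contra fun hne =>
          hj (eq_of_mem_annulus hρ (mem_annulus_of_fderiv_concBump_ne_zero hρ hne) hx)
      rw [gradient_apply, fderiv_bumpSum]
      split_ifs with hkN
      · rw [Finset.sum_eq_single_of_mem k (Finset.mem_range.2 hkN) fun j _ hj => h2 j hj]
      · rw [Finset.sum_eq_zero fun j hj => h2 j fun hjk => hkN (hjk ▸ Finset.mem_range.1 hj),
          zero_apply, mul_zero]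
    · rw [image_eq_zero_of_notMem_tsupport (f := concWeight p i y (radius ρ k))
        fun h => hx (tsupport_concWeight_subset hr h)]
      simp
  simp only [h1]
  split_ifs with hkN
  · exact setIntegral_concWeight_mul_fderiv_concBump hr hs
  · simp

/-- Common to (i) and (ii): along r = r_k the pairing is a nonzero constant, so it cannot tend to 0.
-/
theorem bumpSeries_notMem_funH_of_tendsto {q : ℝ≥0∞} [Fact (1 ≤ q)] [hp : Fact (1 < p)]
    (hρ : 0 < ρ) (hs : ∀ k, annulus y (radius ρ k) ⊆ Ω)
    (hdecay : ∀ g, IsSmoothLimit p q Ω (bumpSeries p i y ρ) g → IsWeakPartial Ω i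
      (bumpSeries p i y ρ) (fun x => g x i) ∧
      Tendsto (fun r => ‖∫ x in Ω, concWeight p i y r x * g x i‖ₑ) (𝓝[>] 0) (𝓝 0)) :
    bumpSeries p i y ρ ∉ funH p q Ω := by
  intro hu
  obtain ⟨g, hg⟩ := exists_isSmoothLimit_of_mem_funH hu
  obtain ⟨hw, hlim⟩ := hdecay g hg
  have h1 := hlim.comp (tendsto_radius_nhdsGT hρ)
  have h2 : (fun r => ‖∫ x in Ω, concWeight p i y r x * g x i‖ₑ) ∘ radius ρ = fun _ =>
      ‖∫ z, coordBump i z * fderiv ℝ (annulusBump i) z (EuclideanSpace.single i 1)‖ₑ := by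
    funext k
    simp only [Function.comp_apply, hw.setIntegral_concWeight hρ (hs k)]
  rw [h2] at h1
  have h3 := tendsto_nhds_unique tendsto_const_nhds h1
  exact integral_coordBump_mul_fderiv_ne_zero i (enorm_eq_zero.1 h3)

end Concentration

/-! ### Non-reflexivity of the Sobolev–Lorentz spaces -/

section NonReflexive

variable {n : ℕ} {p : ℝ} {i : Fin n} {y : EuclideanSpace ℝ (Fin n)} {ρ : ℝ}
  {Ω : TopologicalSpace.Opens (EuclideanSpace ℝ (Fin n))}

/-- Uniformly bounded functionals `f ↦ ∫ w_k ℓ(f)` on weak `L^p`, for the weights `w_k`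
concentrating at `y`. -/
theorem exists_concPairing (hn : 1 ≤ n) (hp : 1 < p) (i : Fin n) (y : EuclideanSpace ℝ (Fin n))
    (hρ : 0 < ρ) (Ω : TopologicalSpace.Opens (EuclideanSpace ℝ (Fin n)))
    {F : Type*} [NormedAddCommGroup F] [NormedSpace ℝ F] {ℓ : F →L[ℝ] ℝ} (hℓ : ‖ℓ‖ ≤ 1) :
    ∃ (f : ℕ → StrongDual ℝ (LorentzOn p ⊤ Ω F)) (C : ℝ), (∀ k, ‖f k‖ ≤ C) ∧
      ∀ k v, f k v = ∫ x in Ω, concWeight p i y (radius ρ k) x * ℓ (v.1 x) := by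
  obtain ⟨M, hM, h⟩ := exists_concWeight_le p i y
  refine ⟨fun k => LorentzSpace.pairing hp hℓ
    (contDiff_concWeight (p := p) (i := i) (y := y)).continuous.aestronglyMeasurable
    (mul_nonneg hM (Real.rpow_nonneg (radius_pos hρ k).le _)) (h _ (radius_pos hρ k))
    (fun x hx => concWeight_eq_zero (radius_pos hρ k) hx) (ballVolume_pos (radius_pos hρ k))
    (restrict_ball_le_ballVolume hn y (radius_pos hρ k) Ω), M * ballVolume n 1 ^ (1 - 1 / p),
    fun k => ?_, fun k v => rfl⟩
  refine (LorentzSpace.norm_pairing_le hp hℓ _ _ _ _ _ _).trans_eq ?_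
  rw [mul_assoc, rpow_mul_ballVolume_rpow (radius_pos hρ k)]

theorem annulus_radius_subset (hρ : 0 < ρ) (hΩ : Metric.closedBall y (3 * ρ) ⊆ Ω) (k : ℕ) :
    annulus y (radius ρ k) ⊆ Ω :=
  (annulus_subset_closedBall.trans (Metric.closedBall_subset_closedBall
    (mul_le_mul_of_nonneg_left (radius_le hρ k) (by norm_num)))).trans hΩ

theorem norm_le_toReal_of_lorentzENorm_le {α F : Type*} [MeasurableSpace α] {μ : Measure α}
    [SFinite μ] [NormedAddCommGroup F] [NormedSpace ℝ F] {q : ℝ≥0∞} [Fact (1 ≤ q)] {K : ℝ≥0∞}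
    (hK : K < ⊤) {v : LorentzSpace p q μ F} {f : α → F} (hv : v.1 =ᵐ[μ] f)
    (h : lorentzENorm p q μ f ≤ K) : ‖v‖ ≤ K.toReal := by
  rw [LorentzSpace.lorentzENorm_eq_enorm_of_ae hv] at h
  rw [← toReal_enorm]
  exact ENNReal.toReal_mono hK.ne h

theorem exists_closedBall_subset (hy : y ∈ Ω) : ∃ ρ > 0, Metric.closedBall y (3 * ρ) ⊆ Ω := by
  obtain ⟨ε, hε, h⟩ := Metric.nhds_basis_closedBall.mem_iff.1 (Ω.isOpen.mem_nhds hy)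
  exact ⟨ε / 3, by positivity, by rwa [mul_div_cancel₀ _ (by norm_num)]⟩

/-- The map T and the functional ℓ cover both descriptions of the derivative: T takes the gradient
and ℓ its i-th coordinate for pairs, while for W^{1,(p,∞)} T takes ∂_i directly and ℓ is the
identity. -/
theorem not_isReflexiveSpace_of_bumpSum (hn : 1 ≤ n) (hp : 1 < p) (hρ : 0 < ρ)
    (hΩ : Metric.closedBall y (3 * ρ) ⊆ Ω) {F : Type*} [NormedAddCommGroup F] [NormedSpace ℝ F]
    {ℓ : F →L[ℝ] ℝ} (hℓ : ‖ℓ‖ ≤ 1) {X : Type*} [NormedAddCommGroup X] [NormedSpace ℝ X]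
    (T : X →L[ℝ] LorentzOn p ⊤ Ω F) (S : ℕ → X) {B : ℝ} (hB : ∀ N, ‖S N‖ ≤ B)
    (hS : ∀ N, ∀ᵐ x ∂(volume.restrict (Ω : Set (EuclideanSpace ℝ (Fin n)))),
      ℓ ((T (S N)).1 x) = gradient (bumpSum p i y ρ N) x i) : ¬ IsReflexiveSpace X := by
  obtain ⟨f, C, hf, hfv⟩ := exists_concPairing hn hp i y hρ Ω hℓ
  have hval : ∀ k N, (f k).comp T (S N) = if k < N then
      ∫ z, coordBump i z * fderiv ℝ (annulusBump i) z (EuclideanSpace.single i 1) else 0 := by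
    intro k N
    rw [← setIntegral_concWeight_bumpSum (p := p) hρ (annulus_radius_subset hρ hΩ k)]
    refine (hfv k _).trans (integral_congr_ae ?_)
    filter_upwards [hS N] with x hx
    exact congrArg (concWeight p i y (radius ρ k) x * ·) hx
  refine not_isReflexiveSpace_of_summing S (fun k => (f k).comp T) hB (C := C * ‖T‖)
    (fun k => ?_) (integral_coordBump_mul_fderiv_ne_zero i) (fun k N h => ?_) (fun k N h => ?_)
  · exact (ContinuousLinearMap.opNorm_comp_le _ _).trans
      (mul_le_mul_of_nonneg_right (hf k) (norm_nonneg _))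
  · rw [hval, if_pos h]
  · rw [hval, if_neg (not_lt.2 h)]

theorem exists_bumpSum_testPairs (hn : 1 ≤ n) [hp : Fact (1 < p)] (i : Fin n) (hρ : 0 < ρ)
    (hΩ : Metric.closedBall y (3 * ρ) ⊆ Ω) :
    ∃ (S : ℕ → LorentzPair p ⊤ Ω) (B : ℝ), ∀ N, S N ∈ testPairs p ⊤ Ω ∧ ‖S N‖ ≤ B ∧
      (S N).snd.1 =ᵐ[volume.restrict Ω] gradient (bumpSum p i y ρ N) := by
  obtain ⟨K, hK, hle⟩ := exists_lorentzENorm_bumpSum_le hn hp.out i y hρ Ω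
  have key : ∀ N, ∃ w : LorentzPair p ⊤ Ω, w ∈ testPairs p ⊤ Ω ∧ ‖w‖ ≤ K.toReal + K.toReal ∧
      w.snd.1 =ᵐ[volume.restrict Ω] gradient (bumpSum p i y ρ N) := fun N => by
    have hφ := contDiff_bumpSum (p := p) (i := i) (y := y) (ρ := ρ) N
    have hm1 := aestronglyMeasurable_of_smoothOn (Ω := Ω) hφ.contDiffOn
    have hm2 := aestronglyMeasurable_gradient_of_smoothOn (Ω := Ω) hφ.contDiffOn
    have hs1 := (hle N).1.trans_lt hK
    have hs2 := (hle N).2.trans_lt hK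
    have h1 := LorentzSpace.coeFn_ofFun _ hm1 hs1
    have h2 := LorentzSpace.coeFn_ofFun _ hm2 hs2
    generalize LorentzSpace.ofFun _ hm1 hs1 = a at h1
    generalize LorentzSpace.ofFun _ hm2 hs2 = b at h2
    refine ⟨WithLp.toLp _ (a, b), ⟨_, hφ, (isCompact_closedBall y (3 * ρ)).of_isClosed_subset
      (isClosed_tsupport _) (tsupport_bumpSum_subset hρ N),
      (tsupport_bumpSum_subset hρ N).trans hΩ, h1, h2⟩, ?_, h2⟩
    exact (WithLp.prod_norm_le_add _).trans (add_le_add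
      (norm_le_toReal_of_lorentzENorm_le hK h1 (hle N).1)
      (norm_le_toReal_of_lorentzENorm_le hK h2 (hle N).2))
  choose S hS using key
  exact ⟨S, _, hS⟩

/-- The obstruction uses only the partial sums, which are test functions; hence one statement
handles H_0 and H. -/
theorem not_isReflexiveSpace_of_testPairs_le (hn : 1 ≤ n) [hp : Fact (1 < p)] (hy : y ∈ Ω)
    {Y : Submodule ℝ (LorentzPair p ⊤ Ω)} (hY : testPairs p ⊤ Ω ≤ Y) : ¬ IsReflexiveSpace Y := by
  obtain ⟨ρ, hρ, hΩ⟩ := exists_closedBall_subset hy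
  obtain ⟨S, B, hS⟩ := exists_bumpSum_testPairs (p := p) hn (⟨0, hn⟩ : Fin n) hρ hΩ
  refine not_isReflexiveSpace_of_bumpSum (i := ⟨0, hn⟩) hn hp.out hρ hΩ (norm_proj_le_one ⟨0, hn⟩)
    ((WithLp.sndL _ ℝ _ _).comp Y.subtypeL) (fun N => ⟨S N, hY (hS N).1⟩)
    (fun N => (hS N).2.1) fun N => ?_
  filter_upwards [(hS N).2.2] with x hx
  exact congrArg (fun v : EuclideanSpace ℝ (Fin n) => v ⟨0, hn⟩) hx

theorem exists_bumpSum_sobolevLorentzW (hn : 1 ≤ n) (hp : 1 < p) (i : Fin n) (hρ : 0 < ρ)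
    (y : EuclideanSpace ℝ (Fin n)) (Ω : TopologicalSpace.Opens (EuclideanSpace ℝ (Fin n))) :
    ∃ (S : ℕ → SobolevLorentzW p ⊤ Ω) (B : ℝ), ∀ N, ‖S N‖ ≤ B ∧
      ∀ j, ((S N).1.snd j).1 =ᵐ[volume.restrict Ω] fun x => gradient (bumpSum p i y ρ N) x j := by
  obtain ⟨K, hK, hle⟩ := exists_lorentzENorm_bumpSum_le hn hp i y hρ Ω
  have key : ∀ N, ∃ w : SobolevLorentzW p ⊤ Ω, ‖w‖ ≤ K.toReal + ∑ _j : Fin n, K.toReal ∧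
      ∀ j, (w.1.snd j).1 =ᵐ[volume.restrict Ω] fun x => gradient (bumpSum p i y ρ N) x j :=
      fun N => by
    have hφ := contDiff_bumpSum (p := p) (i := i) (y := y) (ρ := ρ) N
    have hm1 := aestronglyMeasurable_of_smoothOn (Ω := Ω) hφ.contDiffOn
    have hm2 := fun j => aestronglyMeasurable_apply
      (aestronglyMeasurable_gradient_of_smoothOn (Ω := Ω) hφ.contDiffOn) j
    have hs1 := (hle N).1.trans_lt hK
    have hle2 := fun j => (lorentzENorm_apply_le _ j).trans (hle N).2
    have hs2 := fun j => (hle2 j).trans_lt hK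
    obtain ⟨a, h1⟩ : ∃ a : LorentzOn p ⊤ Ω ℝ, a.1 =ᵐ[volume.restrict Ω] bumpSum p i y ρ N :=
      ⟨_, LorentzSpace.coeFn_ofFun _ hm1 hs1⟩
    obtain ⟨b, h2⟩ : ∃ b : Fin n → LorentzOn p ⊤ Ω ℝ, ∀ j,
        (b j).1 =ᵐ[volume.restrict Ω] fun x => gradient (bumpSum p i y ρ N) x j :=
      ⟨_, fun j => LorentzSpace.coeFn_ofFun _ (hm2 j) (hs2 j)⟩
    refine ⟨⟨WithLp.toLp 1 (a, WithLp.toLp 1 b), fun j => ?_⟩, ?_, h2⟩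
    · have h := isWeakPartial_of_smoothOn (Ω := Ω) (i := j) hφ.contDiffOn
      simp only [← gradient_apply] at h
      exact h.congr h1.symm (h2 j).symm
    · rw [Submodule.coe_norm, WithLp.prod_norm_eq_of_L1, PiLp.norm_eq_of_L1]
      exact add_le_add (norm_le_toReal_of_lorentzENorm_le hK h1 (hle N).1)
        (Finset.sum_le_sum fun j _ => norm_le_toReal_of_lorentzENorm_le hK (h2 j) (hle2 j))
  choose S hS using key
  exact ⟨S, _, hS⟩

theorem not_isReflexiveSpace_sobolevLorentzW (hn : 1 ≤ n) (hp : 1 < p) (hy : y ∈ Ω) :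
    ¬ IsReflexiveSpace (SobolevLorentzW p ⊤ Ω) := by
  obtain ⟨ρ, hρ, hΩ⟩ := exists_closedBall_subset hy
  obtain ⟨S, B, hS⟩ := exists_bumpSum_sobolevLorentzW hn hp (⟨0, hn⟩ : Fin n) hρ y Ω
  refine not_isReflexiveSpace_of_bumpSum (i := ⟨0, hn⟩) hn hp hρ hΩ
    (ContinuousLinearMap.norm_id_le : ‖ContinuousLinearMap.id ℝ ℝ‖ ≤ 1)
    ((PiLp.proj (𝕜 := ℝ) 1 (fun _ : Fin n => LorentzOn p ⊤ Ω ℝ) ⟨0, hn⟩).comp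
      ((WithLp.sndL _ ℝ _ _).comp (SobolevLorentzW p ⊤ Ω).subtypeL)) S
    (fun N => (hS N).1) fun N => ?_
  exact (hS N).2 ⟨0, hn⟩

theorem testPairs_le_smoothPairs {q : ℝ≥0∞} [Fact (1 ≤ q)] :
    testPairs p q Ω ≤ smoothPairs p q Ω := by
  rintro w ⟨φ, hφ, -, -, h1, h2⟩
  exact ⟨φ, hφ.contDiffOn, h1, h2⟩

end NonReflexive

/-! ### The theorem -/

theorem mainTheorem4 (n : ℕ) (hn : 1 ≤ n) (p : ℝ) [Fact (1 < p)]
    (Ω : TopologicalSpace.Opens (EuclideanSpace ℝ (Fin n)))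
    (y : EuclideanSpace ℝ (Fin n)) (hy : y ∈ Ω) :
    (funH p ⊤ Ω ⊂ funW p ⊤ Ω ∩ funH p ⊤ (puncture Ω y)) ∧
    (∀ (q : ℝ≥0∞) [Fact (1 ≤ q)], q ≠ ⊤ → funH p q (puncture Ω y) ⊂ funH p ⊤ (puncture Ω y)) ∧
    (¬ IsReflexiveSpace (SobolevLorentzH0 p ⊤ Ω)) ∧
    (¬ IsReflexiveSpace (SobolevLorentzH p ⊤ Ω)) ∧
    (¬ IsReflexiveSpace (SobolevLorentzW p ⊤ Ω)) := by
  have hp : 1 < p := Fact.out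
  obtain ⟨ρ, hρ, hΩ⟩ := exists_closedBall_subset hy
  set i : Fin n := ⟨0, hn⟩
  have hsub := annulus_radius_subset (Ω := Ω) hρ hΩ
  refine ⟨(ssubset_iff_of_subset fun u hu => ?_).2
    ⟨bumpSeries p i y ρ, ⟨bumpSeries_mem_funW hn i y hρ Ω, bumpSeries_mem_funH hn i y hρ Ω⟩, ?_⟩,
    fun q hq hqt => (ssubset_iff_of_subset fun u hu => ?_).2
    ⟨bumpSeries p i y ρ, bumpSeries_mem_funH hn i y hρ Ω, ?_⟩,
    not_isReflexiveSpace_of_testPairs_le hn hy (testPairs p ⊤ Ω).le_topologicalClosure,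
    not_isReflexiveSpace_of_testPairs_le hn hy
      (testPairs_le_smoothPairs.trans (smoothPairs p ⊤ Ω).le_topologicalClosure),
    not_isReflexiveSpace_sobolevLorentzW hn hp hy⟩
  · obtain ⟨g, hg⟩ := exists_isSmoothLimit_of_mem_funH hu
    exact ⟨hg.mem_funW hp, (hg.puncture hn y).mem_funH⟩
  · exact bumpSeries_notMem_funH_of_tendsto hρ hsub fun g hg =>
      ⟨hg.isWeakPartial hp i, hg.tendsto_concWeight hn hp i hy⟩
  · obtain ⟨g, hg⟩ := exists_isSmoothLimit_of_mem_funH hu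
    exact (hg.to_top hqt).mem_funH
  -- The annuli avoid y, so the same weights are test functions on the punctured set.
  · refine bumpSeries_notMem_funH_of_tendsto hρ (fun k x hx => ⟨hsub k hx,
      ne_of_mem_annulus (radius_pos hρ k) hx⟩) fun g hg =>
      ⟨(hg.to_top hqt).isWeakPartial hp i,
        hg.tendsto_concWeight_of_ne_top hn (zero_lt_one.trans hp) hq.out hqt i y⟩

end
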